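/- Let $G=(V,E)$ be a finite (simple) graph with couplings $J=(J_{uv})_{uv\in E}$, $J_{uv}\ge 0$, and let $\langle\cdot\rangle_J$ be the expectation with respect to the Ising measure on $\{-1,+1\}^V$, $$\mathbb P_G(\sigma)=\frac1{Z_G}\exp\Big[\sum_{uv\in E}J_{uv}\sigma_u\sigma_v\Big],$$ where $Z_G$ is the normalizing constant. For $j_1,\dots,j_n\in V$ ($n\ge 1$) define the Ursell function $$u_n(\sigma_{j_1},\dots,\sigma_{j_n})=\sum_{\mathscr P}(-1)^{|\mathscr P|-1}(|\mathscr P|-1)!\prod_{P\in\mathscr P}\Big\langle\prod_{l\in P}\sigma_{j_l}\Big\rangle_J ,$$ where the sum is over all partitions $\mathscr P$ of $\{1,\dots,n\}$ into nonempty blocks and $|\mathscr P|$ is the number of blocks. Then for every integer $k\ge 1$, all $j_1,\dots,j_{2k}\in V$ (not necessarily distinct) and every edge $u_0v_0\in E$, the function $u_{2k}(\sigma_{j_1},\dots,\sigma_{j_{2k}})$ is differentiable in $J_{u_0v_0}$ and $$(-1)^{k-1}\,\frac{\partial u_{2k}(\sigma_{j_1},\dots,\sigma_{j_{2k}})}{\partial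 J_{u_0v_0}}\ \ge\ 0 .$$ Consequently, $(-1)^{k-1}u_{2k}(\sigma_{j_1},\dots,\sigma_{j_{2k}})\ge 0$ (Shlosman's inequality), and $|u_{2k}(\sigma_{j_1},\dots,\sigma_{j_{2k}})|$ is nondecreasing in the couplings: it does not decrease when $J$ is replaced by $J'$ with $J_{uv}\le J'_{uv}$ for all $uv\in E$. -/

import Mathlib

open scoped Nat

/-- The set of spin configurations `{-1, +1}^V`; the two units of `ℤ` are `-1` and `+1`. -/
abbrev SpinConfig (V : Type*) : Type _ := V → ℤˣ

/-- The spin variable `σ_v` at the vertex `v`, as a real-valued function of the configuration. -/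
def spin {V : Type*} (v : V) (σ : SpinConfig V) : ℝ := ((σ v : ℤ) : ℝ)

/-- The product `σ_u σ_v` of the two spins at the ends of the pair `uv`. -/
def pairSpin {V : Type*} (σ : SpinConfig V) : Sym2 V → ℝ :=
  Sym2.lift ⟨fun u v => spin u σ * spin v σ, fun _ _ => mul_comm _ _⟩

section Ising

variable {V : Type*} [Fintype V] [DecidableEq V] (G : SimpleGraph V) [DecidableRel G.Adj]

/-- The Boltzmann weight `exp (∑_{uv ∈ E} J_{uv} σ_u σ_v)`. -/
noncomputable def isingWeight (J : G.edgeSet → ℝ) (σ : SpinConfig V) : ℝ :=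
  Real.exp (∑ e : G.edgeSet, J e * pairSpin σ e)

/-- The partition function `Z_G`. -/
noncomputable def isingZ (J : G.edgeSet → ℝ) : ℝ := ∑ σ : SpinConfig V, isingWeight G J σ

/-- The probability `ℙ_G(σ)` of a configuration in the Ising model on `G` with couplings `J`. -/
noncomputable def isingProb (J : G.edgeSet → ℝ) (σ : SpinConfig V) : ℝ :=
  isingWeight G J σ / isingZ G J

end Ising

/-- The expectation of `f` when the points of the finite sample space `Ω` have probabilities `p`. -/
def expect {Ω : Type*} [Fintype Ω] (p : Ω → ℝ) (f : Ω → ℝ) : ℝ := ∑ ω : Ω, p ω * f ω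

/-- The Ursell function (joint cumulant) `u_n(X_1, …, X_n)` of random variables on a finite
probability space: the sum over all partitions `P` of the index set, into `|P|` nonempty blocks,
of `(-1)^(|P|-1) (|P|-1)! ∏_{B ∈ P} ⟨∏_{i ∈ B} X_i⟩`. -/
def ursell {Ω : Type*} [Fintype Ω] (p : Ω → ℝ) {n : ℕ} (X : Fin n → Ω → ℝ) : ℝ :=
  ∑ P : Finpartition (Finset.univ : Finset (Fin n)),
    (-1 : ℝ) ^ (P.parts.card - 1) * ((P.parts.card - 1)! : ℝ) *
      ∏ B ∈ P.parts, expect p (fun ω => ∏ i ∈ B, X i ω)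

/-- `u_n(σ_{j_1}, …, σ_{j_n})` in the Ising model on `G` with couplings `J`. -/
noncomputable def isingUrsell {V : Type*} [Fintype V] [DecidableEq V] (G : SimpleGraph V)
    [DecidableRel G.Adj] {n : ℕ} (j : Fin n → V) (J : G.edgeSet → ℝ) : ℝ :=
  ursell (isingProb G J) (fun i => spin (j i))

set_option linter.unusedSectionVars false

/-! ### Functions of the spins with nonnegative even expansions -/

section EvenCone

variable {V : Type*}

/-! Give each index `i` a source, that is, a factor 1 + y_i σ_{s i} in the weight, with y_i² = 0. In
the algebra of set functions under subset convolution, the mean of σ_w with sources then generates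
the Ursell functions of w together with the sources in A, and the mean of σ_u σ_v has at nonempty A
the derivative of the Ursell function of A in the coupling of uv. Formally, moments are the
exponential of Ursell functions; the proof only uses the recursion `sum_setUrsell_mul`. Taking y_i =
I x_i reduces both sign statements to `ImaginarySources.positivity`: the magnetization is I times a
nonnegative series, and a pair correlation is a constant minus a nonnegative nilpotent series.

Positivity goes by induction on the set of sources. As y_i² = 0, a new source changes a mean ⟨f⟩ by
y_i times the truncated correlation of f and σ_{s i}. Write that correlation with two copies σ, τ of
the system. The set where they disagree does not interact with its complement, so the cluster C of s
i inside it can be summed out (`spin_sub_mul_bondWeight_mul`). Sources on C cancel between the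
copies, and what is left is the system with C decoupled. By spin-flip symmetry and Griffiths'
inequality, the two-point function becomes a nonnegative combination of Z_C², and the three-point
function one of Z_C² times a magnetization of the decoupled system, which contributes a factor I.

The ratios Z_C/Z are nonnegative by the induction hypothesis: deleting a source or a coupling
multiplies Z by the inverse of a positive constant minus a nonnegative nilpotent, which is a
geometric series. Hence the magnetization changes by I x_i Q and the pair correlation by I x_i · I Q
= -x_i Q with Q ≥ 0. Comparing powers of I at |A| = 2k - 1 and |A| = 2k gives the signs.
Monotonicity of the absolute value follows by raising the couplings one at a time. -/

lemma spin_mul_self (v : V) (σ : SpinConfig V) : spin v σ * spin v σ = 1 := by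
  rcases Int.units_eq_one_or (σ v) with h | h <;> simp [spin, h]

lemma spin_eq_or (v : V) (σ : SpinConfig V) : spin v σ = 1 ∨ spin v σ = -1 := by
  rcases Int.units_eq_one_or (σ v) with h | h <;> simp [spin, h]

lemma spin_congr {v : V} {σ τ : SpinConfig V} (h : σ v = τ v) : spin v σ = spin v τ := by
  simp [spin, h]

lemma spin_neg {v : V} {σ τ : SpinConfig V} (h : τ v = -σ v) : spin v τ = -spin v σ := by
  simp [spin, h]

/-- The semiring of functions on spin configurations generated by the nonnegative constants and by
the products of two spins in `C`. -/
def evenCone (C : Finset V) : Subsemiring (SpinConfig V → ℝ) :=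
  Subsemiring.closure ({f | ∃ r : ℝ, 0 ≤ r ∧ f = fun _ => r} ∪
    {f | ∃ u ∈ C, ∃ v ∈ C, f = fun σ => spin u σ * spin v σ})

namespace evenCone

lemma const_mem (C : Finset V) {r : ℝ} (hr : 0 ≤ r) : (fun _ => r) ∈ evenCone C :=
  Subsemiring.subset_closure (Or.inl ⟨r, hr, rfl⟩)

lemma pair_mem {C : Finset V} {u v : V} (hu : u ∈ C) (hv : v ∈ C) :
    (fun σ => spin u σ * spin v σ) ∈ evenCone C :=
  Subsemiring.subset_closure (Or.inr ⟨u, hu, v, hv, rfl⟩)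

lemma mono {C D : Finset V} (h : C ⊆ D) : evenCone C ≤ evenCone D := by
  refine Subsemiring.closure_mono (Set.union_subset_union_right _ ?_)
  rintro f ⟨u, hu, v, hv, rfl⟩
  exact ⟨u, h hu, v, h hv, rfl⟩

lemma apply_congr {C : Finset V} {f : SpinConfig V → ℝ} (hf : f ∈ evenCone C)
    {σ τ : SpinConfig V} (h : ∀ v ∈ C, σ v = τ v) : f σ = f τ := by
  induction hf using Subsemiring.closure_induction with
  | mem f hf =>
    rcases hf with ⟨r, -, rfl⟩ | ⟨u, hu, v, hv, rfl⟩
    · rfl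
    · simp only [spin_congr (h u hu), spin_congr (h v hv)]
  | zero => rfl
  | one => rfl
  | add f g _ _ hf hg => simp [hf, hg]
  | mul f g _ _ hf hg => simp [hf, hg]

lemma apply_neg {C : Finset V} {f : SpinConfig V → ℝ} (hf : f ∈ evenCone C)
    {σ τ : SpinConfig V} (h : ∀ v ∈ C, τ v = -σ v) : f τ = f σ := by
  induction hf using Subsemiring.closure_induction with
  | mem f hf =>
    rcases hf with ⟨r, -, rfl⟩ | ⟨u, hu, v, hv, rfl⟩
    · rfl
    · simp only [spin_neg (h u hu), spin_neg (h v hv), neg_mul_neg]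
  | zero => rfl
  | one => rfl
  | add f g _ _ hf hg => simp [hf, hg]
  | mul f g _ _ hf hg => simp [hf, hg]

/-- A product p of two spins is ±1, so exp(tp) = cosh t + p sinh t. -/
lemma exp_sub_one_mem {C : Finset V} {u v : V} (hu : u ∈ C) (hv : v ∈ C) {t : ℝ} (ht : 0 ≤ t) :
    (fun σ => Real.exp (t * (spin u σ * spin v σ)) - 1) ∈ evenCone C := by
  have h : (fun σ => Real.exp (t * (spin u σ * spin v σ)) - 1) =
      (fun _ => Real.cosh t - 1) + (fun _ => Real.sinh t) * fun σ => spin u σ * spin v σ := by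
    funext σ
    have hc := Real.cosh_add_sinh t
    have hs := Real.cosh_sub_sinh t
    rcases spin_eq_or u σ with h1 | h1 <;> rcases spin_eq_or v σ with h2 | h2 <;>
      simp [h1, h2] <;> linarith
  rw [h]
  exact add_mem (const_mem C (by linarith [Real.one_le_cosh t]))
    (mul_mem (const_mem C (Real.sinh_nonneg_iff.2 ht)) (pair_mem hu hv))

lemma exp_sum_sub_one_mem {β : Type*} {C : Finset V} (s : Finset β) (t : β → ℝ) (u v : β → V)
    (ht : ∀ b ∈ s, 0 ≤ t b) (hu : ∀ b ∈ s, u b ∈ C) (hv : ∀ b ∈ s, v b ∈ C) :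
    (fun σ => Real.exp (∑ b ∈ s, t b * (spin (u b) σ * spin (v b) σ)) - 1) ∈ evenCone C := by
  classical
  induction s using Finset.induction_on with
  | empty =>
    convert (evenCone C).zero_mem using 1
    funext σ
    simp
  | insert b s hb ih =>
    have ih' := ih (fun c hc => ht c (Finset.mem_insert_of_mem hc))
      (fun c hc => hu c (Finset.mem_insert_of_mem hc))
      (fun c hc => hv c (Finset.mem_insert_of_mem hc))
    have hb' := exp_sub_one_mem (hu b (Finset.mem_insert_self b s))
      (hv b (Finset.mem_insert_self b s)) (ht b (Finset.mem_insert_self b s))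
    -- ab - 1 = (a - 1)(b - 1) + (a - 1) + (b - 1).
    have := add_mem (add_mem (mul_mem hb' ih') hb') ih'
    convert this using 1
    funext σ
    simp only [Finset.sum_insert hb, Real.exp_add, Pi.add_apply, Pi.mul_apply]
    ring

lemma exp_sum_mem {β : Type*} {C : Finset V} (s : Finset β) (t : β → ℝ) (u v : β → V)
    (ht : ∀ b ∈ s, 0 ≤ t b) (hu : ∀ b ∈ s, u b ∈ C) (hv : ∀ b ∈ s, v b ∈ C) :
    (fun σ => Real.exp (∑ b ∈ s, t b * (spin (u b) σ * spin (v b) σ))) ∈ evenCone C := by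
  convert add_mem (exp_sum_sub_one_mem s t u v ht hu hv) (one_mem _) using 1
  funext σ
  simp

variable [Fintype V] [DecidableEq V]

/-- The sum factorizes over the vertices, with factor 0 on A and 2 off A. -/
lemma sum_prod_spin_nonneg (A : Finset V) :
    0 ≤ ∑ σ : SpinConfig V, ∏ v ∈ A, spin v σ := by
  have h : ∀ σ : SpinConfig V, ∏ v ∈ A, spin v σ =
      ∏ v, if v ∈ A then ((σ v : ℤ) : ℝ) else 1 := fun σ => by
    rw [Finset.prod_ite_mem, Finset.univ_inter]; rfl
  simp_rw [h]
  rw [← Fintype.piFinset_univ, ← Finset.prod_univ_sum (fun _ : V => (Finset.univ : Finset ℤˣ))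
    (fun v s => if v ∈ A then ((s : ℤ) : ℝ) else 1)]
  refine Finset.prod_nonneg fun v _ => ?_
  by_cases hv : v ∈ A <;> simp [hv, Finset.univ, Fintype.elems]

/-- As σ_v² = 1, spin monomials multiply by symmetric difference of their supports. -/
lemma exists_eq_of_mem_closure {C : Finset V} {f : SpinConfig V → ℝ}
    (hf : f ∈ Submonoid.closure ({f : SpinConfig V → ℝ | ∃ r : ℝ, 0 ≤ r ∧ f = fun _ => r} ∪
      {f | ∃ u ∈ C, ∃ v ∈ C, f = fun σ => spin u σ * spin v σ})) :
    ∃ (r : ℝ) (A : Finset V), 0 ≤ r ∧ f = fun σ => r * ∏ v ∈ A, spin v σ := by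
  have key : ∀ (A B : Finset V) (σ : SpinConfig V),
      (∏ v ∈ A, spin v σ) * ∏ v ∈ B, spin v σ = ∏ v ∈ symmDiff A B, spin v σ := by
    intro A B σ
    have h : ∀ A : Finset V, ∏ v ∈ A, spin v σ = ∏ v, if v ∈ A then spin v σ else 1 := fun A => by
      rw [Finset.prod_ite_mem, Finset.univ_inter]
    rw [h, h, h, ← Finset.prod_mul_distrib]
    refine Finset.prod_congr rfl fun v _ => ?_
    by_cases h1 : v ∈ A <;> by_cases h2 : v ∈ B <;>
      simp [h1, h2, Finset.mem_symmDiff, spin_mul_self]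
  induction hf using Submonoid.closure_induction with
  | mem f hf =>
    rcases hf with ⟨r, hr, rfl⟩ | ⟨u, hu, v, hv, rfl⟩
    · exact ⟨r, ∅, hr, by simp⟩
    · refine ⟨1, symmDiff {u} {v}, zero_le_one, ?_⟩
      funext σ
      rw [← key]
      simp
  | one => exact ⟨1, ∅, zero_le_one, by funext; simp⟩
  | mul f g _ _ hf hg =>
    obtain ⟨r, A, hr, rfl⟩ := hf
    obtain ⟨s, B, hs, rfl⟩ := hg
    refine ⟨r * s, symmDiff A B, mul_nonneg hr hs, ?_⟩
    funext σ
    rw [← key, Pi.mul_apply]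
    ring

/-- Griffiths' first inequality: f is a sum of nonnegative multiples of spin monomials. -/
lemma sum_nonneg {C : Finset V} {f : SpinConfig V → ℝ} (hf : f ∈ evenCone C) :
    0 ≤ ∑ σ, f σ := by
  rw [evenCone, Subsemiring.mem_closure_iff] at hf
  induction hf using AddSubmonoid.closure_induction with
  | mem f hf =>
    obtain ⟨r, A, hr, rfl⟩ := exists_eq_of_mem_closure hf
    rw [← Finset.mul_sum]
    exact mul_nonneg hr (sum_prod_spin_nonneg A)
  | zero => simp
  | add f g _ _ hf hg =>
    simp only [Pi.add_apply, Finset.sum_add_distrib]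
    exact add_nonneg hf hg

end evenCone

end EvenCone

/-! ### Cluster expansion -/

section Cluster

variable {V : Type*} [DecidableEq V]

/-- The interaction energy of the pairs inside `D`. -/
def innerEnergy (K : V × V → ℝ) (D : Finset V) (σ : SpinConfig V) : ℝ :=
  ∑ p ∈ D ×ˢ D, K p * (spin p.1 σ * spin p.2 σ)

/-- The factor by which the interaction of `y` with `A` differs from `1`. -/
noncomputable def linkFactor (K : V × V → ℝ) (A : Finset V) (y : V) (σ : SpinConfig V) : ℝ :=
  Real.exp (∑ u ∈ A, (K (u, y) + K (y, u)) * (spin u σ * spin y σ)) - 1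

/-- The weight of `C` as the union of the clusters of the points of `A`, defined by exploring
first the neighbours of `A`. -/
noncomputable def clusterWeight (K : V × V → ℝ) (A C : Finset V) : SpinConfig V → ℝ :=
  if h : A.Nonempty ∧ A ⊆ C then
    fun σ => ∑ N ∈ (C \ A).powerset,
      Real.exp (innerEnergy K A σ) * (∏ y ∈ N, linkFactor K A y σ) * clusterWeight K N (C \ A) σ
  else if A = ∅ ∧ C = ∅ then 1 else 0
termination_by C.card
decreasing_by
  exact Finset.card_lt_card (Finset.sdiff_ssubset h.2 h.1)

/-- The pairs in D lie inside A, inside D \ A, or are mixed; mixed pairs occur in both orders, hence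
the two couplings in `linkFactor`. -/
lemma innerEnergy_exp_eq (K : V × V → ℝ) {A D : Finset V} (h : A ⊆ D) (σ : SpinConfig V) :
    Real.exp (innerEnergy K D σ) = Real.exp (innerEnergy K A σ) *
      (∏ y ∈ D \ A, (1 + linkFactor K A y σ)) * Real.exp (innerEnergy K (D \ A) σ) := by
  simp only [linkFactor, add_sub_cancel]
  rw [← Real.exp_sum, ← Real.exp_add, ← Real.exp_add]
  congr 1
  have hd : Disjoint A (D \ A) := Finset.disjoint_sdiff
  have hD : D = A ∪ (D \ A) := (Finset.union_sdiff_of_subset h).symm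
  simp only [innerEnergy, Finset.sum_product]
  conv_lhs => rw [hD]
  simp only [Finset.sum_union hd, Finset.sum_add_distrib, add_mul]
  rw [Finset.sum_comm (s := D \ A) (t := A) (f := fun y u => K (u, y) * (spin u σ * spin y σ))]
  have : ∀ y u, K (y, u) * (spin u σ * spin y σ) = K (y, u) * (spin y σ * spin u σ) :=
    fun y u => by ring
  simp only [this]
  ring

/-- Membership in the cone yields all that is needed of a cluster weight: it depends only on the
spins in C, is invariant under flipping C, and obeys Griffiths' inequality. -/
lemma clusterWeight_mem (K : V × V → ℝ) (hK : ∀ p, 0 ≤ K p) (A C : Finset V) :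
    clusterWeight K A C ∈ evenCone C := by
  induction hn : C.card using Nat.strong_induction_on generalizing A C with
  | _ n ih =>
    rw [clusterWeight]
    split_ifs with h h'
    · have : (fun σ => ∑ N ∈ (C \ A).powerset,
          Real.exp (innerEnergy K A σ) * (∏ y ∈ N, linkFactor K A y σ) *
            clusterWeight K N (C \ A) σ) = ∑ N ∈ (C \ A).powerset,
          (fun σ => Real.exp (innerEnergy K A σ)) * (∏ y ∈ N, linkFactor K A y) *
            clusterWeight K N (C \ A) := by
        funext σ
        simp [Finset.sum_apply, Finset.prod_apply]
      rw [this]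
      refine sum_mem fun N hN => mul_mem (mul_mem ?_ (prod_mem fun y hy => ?_)) ?_
      · exact evenCone.exp_sum_mem _ _ _ _ (fun p _ => hK p)
          (fun p hp => h.2 (Finset.mem_product.1 hp).1)
          (fun p hp => h.2 (Finset.mem_product.1 hp).2)
      · exact evenCone.exp_sum_sub_one_mem A _ _ (fun _ => y)
          (fun u _ => add_nonneg (hK _) (hK _)) (fun u hu => h.2 hu)
          (fun _ _ => (Finset.mem_sdiff.1 (Finset.mem_powerset.1 hN hy)).1)
      · exact evenCone.mono Finset.sdiff_subset
          (ih _ (hn ▸ Finset.card_lt_card (Finset.sdiff_ssubset h.2 h.1)) N (C \ A) rfl)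
    · exact one_mem _
    · exact zero_mem _

lemma clusterWeight_eq_zero (K : V × V → ℝ) {A C : Finset V} (h : ¬ A ⊆ C) :
    clusterWeight K A C = 0 := by
  rw [clusterWeight, dif_neg (fun h' => h h'.2), if_neg]
  rintro ⟨rfl, rfl⟩
  exact h le_rfl

lemma exp_innerEnergy_eq_sum_cluster (K : V × V → ℝ) {A D : Finset V} (h : A ⊆ D)
    (σ : SpinConfig V) :
    Real.exp (innerEnergy K D σ) =
      ∑ C ∈ D.powerset, clusterWeight K A C σ * Real.exp (innerEnergy K (D \ C) σ) := by
  induction hn : D.card using Nat.strong_induction_on generalizing A D with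
  | _ n ih =>
    rcases A.eq_empty_or_nonempty with rfl | hA
    · rw [Finset.sum_eq_single ∅]
      · simp [clusterWeight]
      · intro C _ hC
        simp [clusterWeight, hC]
      · simp
    · have hlt : (D \ A).card < n := hn ▸ Finset.card_lt_card (Finset.sdiff_ssubset h hA)
      -- The set N of points whose link factor is chosen in the product is the next layer of the
      -- exploration; a cluster C of N in D \ A gives the cluster A ∪ C of A.
      rw [innerEnergy_exp_eq K h, Finset.prod_one_add, Finset.mul_sum, Finset.sum_mul]
      have h1 : ∀ N ∈ (D \ A).powerset,
          Real.exp (innerEnergy K A σ) * (∏ y ∈ N, linkFactor K A y σ) *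
            Real.exp (innerEnergy K (D \ A) σ) = ∑ C ∈ (D \ A).powerset,
            Real.exp (innerEnergy K A σ) * (∏ y ∈ N, linkFactor K A y σ) *
              clusterWeight K N C σ * Real.exp (innerEnergy K ((D \ A) \ C) σ) := by
        intro N hN
        rw [ih _ hlt (Finset.mem_powerset.1 hN) rfl, Finset.mul_sum]
        exact Finset.sum_congr rfl fun C _ => by ring
      rw [Finset.sum_congr rfl h1, Finset.sum_comm]
      have h2 : ∑ C ∈ D.powerset, clusterWeight K A C σ * Real.exp (innerEnergy K (D \ C) σ) =
          ∑ C ∈ D.powerset with A ⊆ C,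
            clusterWeight K A C σ * Real.exp (innerEnergy K (D \ C) σ) := by
        rw [Finset.sum_filter_of_ne]
        intro C _ hC
        by_contra hAC
        exact hC (by rw [clusterWeight_eq_zero K hAC]; simp)
      rw [h2]
      refine Finset.sum_bij' (fun C _ => A ∪ C) (fun C _ => C \ A) ?_ ?_ ?_ ?_ ?_
      · intro C hC
        simp only [Finset.mem_filter, Finset.mem_powerset] at hC ⊢
        exact ⟨Finset.union_subset h (hC.trans Finset.sdiff_subset), Finset.subset_union_left⟩
      · intro C hC
        simp only [Finset.mem_filter, Finset.mem_powerset] at hC ⊢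
        exact Finset.sdiff_subset_sdiff hC.1 le_rfl
      · intro C hC
        rw [Finset.mem_powerset] at hC
        exact Finset.union_sdiff_cancel_left (Finset.disjoint_sdiff.mono_right hC)
      · intro C hC
        exact Finset.union_sdiff_of_subset (Finset.mem_filter.1 hC).2
      · intro C hC
        rw [Finset.mem_powerset] at hC
        have h3 : (A ∪ C) \ A = C :=
          Finset.union_sdiff_cancel_left (Finset.disjoint_sdiff.mono_right hC)
        have h4 : clusterWeight K A (A ∪ C) σ = ∑ N ∈ C.powerset,
            Real.exp (innerEnergy K A σ) * (∏ y ∈ N, linkFactor K A y σ) *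
              clusterWeight K N C σ := by
          rw [clusterWeight, dif_pos ⟨hA, Finset.subset_union_left⟩, h3]
        have h5 : (D \ A) \ C = D \ (A ∪ C) := sdiff_sdiff_left
        rw [h4, Finset.sum_mul, h5]
        refine (Finset.sum_subset (Finset.powerset_mono.2 hC) fun N _ hN => ?_).symm
        rw [clusterWeight_eq_zero K (fun h' => hN (Finset.mem_powerset.2 h'))]
        simp

end Cluster

/-! ### Correlations with nilpotent sources and the duplication identity -/

section Factorization

variable {V α R : Type*} [Fintype V] [DecidableEq V] [Fintype α] [CommRing R]

/-- Sums over configurations of a function of the values on `C` times a function of the values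
off `C` factorize. -/
lemma card_mul_sum_mul_eq (C : Finset V) (F G : (V → α) → R)
    (hF : ∀ σ τ : V → α, (∀ v ∈ C, σ v = τ v) → F σ = F τ)
    (hG : ∀ σ τ : V → α, (∀ v ∉ C, σ v = τ v) → G σ = G τ) :
    (Fintype.card (V → α) : R) * ∑ σ, F σ * G σ = (∑ σ, F σ) * ∑ σ, G σ := by
  have h : (Fintype.card (V → α) : R) * ∑ σ, F σ * G σ =
      ∑ p : (V → α) × (V → α), F p.1 * G p.1 := by
    rw [Fintype.sum_prod_type]
    simp [Finset.mul_sum]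
  rw [h, Finset.sum_mul_sum, ← Fintype.sum_prod_type' (fun σ τ => F σ * G τ)]
  -- Exchanging the two independent copies off C is an involution of the pairs.
  refine Finset.sum_nbij' (fun p => (C.piecewise p.1 p.2, C.piecewise p.2 p.1))
    (fun p => (C.piecewise p.1 p.2, C.piecewise p.2 p.1)) (by simp) (by simp) ?_ ?_ ?_
  · rintro ⟨σ, τ⟩ -
    ext v <;> by_cases hv : v ∈ C <;> simp [hv]
  · rintro ⟨σ, τ⟩ -
    ext v <;> by_cases hv : v ∈ C <;> simp [hv]
  · rintro ⟨σ, τ⟩ -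
    exact congrArg₂ _ (hF _ _ fun v hv => by simp [hv]) (hG _ _ fun v hv => by simp [hv])

end Factorization

section Correlations

variable {V : Type*} [Fintype V] [DecidableEq V]

/-- The Boltzmann weight with pair couplings `K`. -/
noncomputable def bondWeight (K : V × V → ℝ) (σ : SpinConfig V) : ℝ :=
  Real.exp (∑ p, K p * (spin p.1 σ * spin p.2 σ))

/-- The couplings `K` with those touching `C` set to zero. -/
def decouple (K : V × V → ℝ) (C : Finset V) (p : V × V) : ℝ :=
  if p.1 ∈ C ∨ p.2 ∈ C then 0 else K p

/-- The set of vertices where two configurations differ. -/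
def disagreement (σ τ : SpinConfig V) : Finset V := Finset.univ.filter fun v => σ v ≠ τ v

lemma mem_disagreement {σ τ : SpinConfig V} {v : V} :
    v ∈ disagreement σ τ ↔ σ v = -τ v := by
  simp [disagreement, Int.units_ne_iff_eq_neg]

lemma spin_of_mem {σ τ : SpinConfig V} {v : V} (h : v ∈ disagreement σ τ) :
    spin v τ = -spin v σ :=
  spin_neg (by rw [mem_disagreement.1 h, neg_neg])

lemma spin_of_notMem {σ τ : SpinConfig V} {v : V} (h : v ∉ disagreement σ τ) :
    spin v τ = spin v σ :=
  spin_congr (by simpa [disagreement, eq_comm] using h)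

lemma innerEnergy_eq_sum (K : V × V → ℝ) (D : Finset V) (σ : SpinConfig V) :
    innerEnergy K D σ = ∑ p, if p.1 ∈ D ∧ p.2 ∈ D then K p * (spin p.1 σ * spin p.2 σ) else 0 := by
  rw [innerEnergy, ← Finset.sum_filter]
  refine Finset.sum_congr ?_ fun _ _ => rfl
  ext p
  simp

/-- The energies of a pair in the two copies coincide if its ends both agree or both disagree, and
cancel if only one end disagrees. So the disagreement set and its complement do not interact, and
the couplings double. -/
lemma bondWeight_decouple_mul (K : V × V → ℝ) {C : Finset V} {σ τ : SpinConfig V}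
    (hC : C ⊆ disagreement σ τ) :
    bondWeight (decouple K C) σ * bondWeight (decouple K C) τ =
      Real.exp (innerEnergy (fun p => 2 * K p) (disagreement σ τ \ C) σ) *
      Real.exp (innerEnergy (fun p => 2 * K p) (disagreement σ τ)ᶜ σ) := by
  rw [bondWeight, bondWeight, ← Real.exp_add, ← Real.exp_add, innerEnergy_eq_sum,
    innerEnergy_eq_sum, ← Finset.sum_add_distrib, ← Finset.sum_add_distrib]
  congr 1
  refine Finset.sum_congr rfl fun p _ => ?_
  simp only [decouple, Finset.mem_sdiff, Finset.mem_compl]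
  by_cases c1 : p.1 ∈ C
  · simp [c1, hC c1]
  by_cases c2 : p.2 ∈ C
  · simp [c2, hC c2]
  by_cases h1 : p.1 ∈ disagreement σ τ <;> by_cases h2 : p.2 ∈ disagreement σ τ
  all_goals first | rw [spin_of_mem h1] | rw [spin_of_notMem h1]
  all_goals first | rw [spin_of_mem h2] | rw [spin_of_notMem h2]
  all_goals simp [c1, c2, h1, h2]
  all_goals ring

lemma decouple_empty (K : V × V → ℝ) : decouple K ∅ = K := by
  funext p; simp [decouple]

/-- Cluster expansion of two copies of the weight from a vertex where they may disagree. -/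
lemma spin_sub_mul_bondWeight_mul (K : V × V → ℝ) (w : V) (σ τ : SpinConfig V) :
    (spin w σ - spin w τ) * (bondWeight K σ * bondWeight K τ) =
      ∑ C : Finset V, if C ⊆ disagreement σ τ then
        2 * (clusterWeight (fun p => 2 * K p) {w} C σ * spin w σ) *
          (bondWeight (decouple K C) σ * bondWeight (decouple K C) τ) else 0 := by
  rw [← Finset.sum_filter]
  have hf : Finset.univ.filter (fun C => C ⊆ disagreement σ τ) =
      (disagreement σ τ).powerset := by ext; simp
  rw [hf]
  by_cases hw : w ∈ disagreement σ τ
  · have h := bondWeight_decouple_mul K (Finset.empty_subset (disagreement σ τ))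
    rw [decouple_empty, Finset.sdiff_empty] at h
    rw [h, exp_innerEnergy_eq_sum_cluster _ (Finset.singleton_subset_iff.2 hw), spin_of_mem hw,
      Finset.sum_mul, Finset.mul_sum]
    refine Finset.sum_congr rfl fun C hC => ?_
    rw [bondWeight_decouple_mul K (Finset.mem_powerset.1 hC)]
    ring
  · rw [spin_of_notMem hw, sub_self, zero_mul]
    refine (Finset.sum_eq_zero fun C hC => ?_).symm
    rw [clusterWeight_eq_zero]
    · simp
    · exact fun h => hw (Finset.mem_powerset.1 hC (h (Finset.mem_singleton_self w)))

lemma bondWeight_decouple_congr (K : V × V → ℝ) {C : Finset V} {σ τ : SpinConfig V}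
    (h : ∀ v ∉ C, σ v = τ v) : bondWeight (decouple K C) σ = bondWeight (decouple K C) τ := by
  unfold bondWeight
  congr 1
  refine Finset.sum_congr rfl fun p _ => ?_
  by_cases hp : p.1 ∈ C ∨ p.2 ∈ C
  · simp [decouple, hp]
  · rw [not_or] at hp
    rw [spin_congr (h _ hp.1), spin_congr (h _ hp.2)]

variable {ι R : Type*} [DecidableEq ι] [CommRing R] [Algebra ℝ R]

/-- The weight of the sources in `B`, the source `i` having strength `y i` and position `s i`. -/
def sourceFactor (y : ι → R) (s : ι → V) (B : Finset ι) (σ : SpinConfig V) : R :=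
  ∏ i ∈ B, (1 + algebraMap ℝ R (spin (s i) σ) * y i)

/-- The unnormalized correlation of `f` with pair couplings `K` and the sources in `B`. -/
noncomputable def corr (K : V × V → ℝ) (y : ι → R) (s : ι → V) (B : Finset ι)
    (f : SpinConfig V → ℝ) : R :=
  ∑ σ, algebraMap ℝ R (f σ * bondWeight K σ) * sourceFactor y s B σ

variable (K : V × V → ℝ) (y : ι → R) (s : ι → V) (B : Finset ι)

/-- At a source on C the copies have opposite spins, and (1 + σy)(1 - σy) = 1 because y² = 0. -/
lemma sourceFactor_mul (hy : ∀ i, y i * y i = 0) {C : Finset V} {σ τ : SpinConfig V}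
    (hC : C ⊆ disagreement σ τ) :
    sourceFactor y s B σ * sourceFactor y s B τ =
      sourceFactor y s (B.filter fun i => s i ∉ C) σ *
        sourceFactor y s (B.filter fun i => s i ∉ C) τ := by
  simp only [sourceFactor, ← Finset.prod_mul_distrib]
  rw [Finset.prod_filter]
  refine Finset.prod_congr rfl fun i _ => ?_
  by_cases hi : s i ∈ C
  · rw [if_neg (not_not.2 hi), spin_of_mem (hC hi), map_neg]
    have h1 : algebraMap ℝ R (spin (s i) σ) * algebraMap ℝ R (spin (s i) σ) = 1 := by
      rw [← map_mul, spin_mul_self, map_one]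
    linear_combination (-algebraMap ℝ R (spin (s i) σ) ^ 2) * hy i
  · rw [if_pos hi]

lemma sourceFactor_filter_congr {C : Finset V} {σ τ : SpinConfig V} (h : ∀ v ∉ C, σ v = τ v) :
    sourceFactor y s (B.filter fun i => s i ∉ C) σ =
      sourceFactor y s (B.filter fun i => s i ∉ C) τ := by
  refine Finset.prod_congr rfl fun i hi => ?_
  rw [spin_congr (h _ (Finset.mem_filter.1 hi).2)]

/-- The left side is the mean of f(σ)(σ_w - τ_w) over two copies. It only sees configurations that
disagree at w, where the cluster of w can be expanded. -/
lemma corr_mul_sub (w : V) (f : SpinConfig V → ℝ) (hy : ∀ i, y i * y i = 0) :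
    corr K y s B (fun σ => f σ * spin w σ) * corr K y s B 1 -
      corr K y s B f * corr K y s B (spin w) =
    ∑ C : Finset V, ∑ σ, ∑ τ, if C ⊆ disagreement σ τ then
      algebraMap ℝ R (2 * f σ * (clusterWeight (fun p => 2 * K p) {w} C σ * spin w σ)) *
      ((algebraMap ℝ R (bondWeight (decouple K C) σ) *
        sourceFactor y s (B.filter fun i => s i ∉ C) σ) *
       (algebraMap ℝ R (bondWeight (decouple K C) τ) *
        sourceFactor y s (B.filter fun i => s i ∉ C) τ)) else 0 := by
  have h : corr K y s B (fun σ => f σ * spin w σ) * corr K y s B 1 -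
      corr K y s B f * corr K y s B (spin w) = ∑ σ, ∑ τ,
      algebraMap ℝ R (f σ * ((spin w σ - spin w τ) * (bondWeight K σ * bondWeight K τ))) *
        (sourceFactor y s B σ * sourceFactor y s B τ) := by
    simp only [corr, Finset.sum_mul_sum, ← Finset.sum_sub_distrib]
    refine Finset.sum_congr rfl fun σ _ => Finset.sum_congr rfl fun τ _ => ?_
    simp only [map_mul, map_sub, Pi.one_apply, map_one]
    ring
  rw [h, Finset.sum_comm]
  conv_rhs => rw [Finset.sum_comm]; enter [2, σ]; rw [Finset.sum_comm]
  rw [Finset.sum_comm]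
  refine Finset.sum_congr rfl fun σ _ => Finset.sum_congr rfl fun τ _ => ?_
  rw [spin_sub_mul_bondWeight_mul, Finset.mul_sum, map_sum, Finset.sum_mul]
  refine Finset.sum_congr rfl fun C _ => ?_
  split_ifs with hC
  · rw [sourceFactor_mul y s B hy hC]
    simp only [map_mul]
    ring
  · simp

lemma sum_disagreement (C : Finset V) (σ : SpinConfig V) (g : SpinConfig V → R)
    (hg : ∀ σ τ : SpinConfig V, (∀ v ∉ C, σ v = τ v) → g σ = g τ) :
    (Fintype.card (SpinConfig V) : R) * ∑ τ, (if C ⊆ disagreement σ τ then g τ else 0) =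
      ((Finset.univ.filter fun τ : SpinConfig V => ∀ v ∈ C, τ v = -1).card : R) * ∑ τ, g τ := by
  have h1 : ∑ τ, (if C ⊆ disagreement σ τ then g τ else 0) =
      ∑ τ : SpinConfig V, (if ∀ v ∈ C, τ v = -1 then (1 : R) else 0) * g τ := by
    -- Multiplying τ by σ on C is an involution that turns disagreement on C into τ = -1 on C, a
    -- condition free of σ.
    refine Finset.sum_nbij' (fun τ => C.piecewise (σ * τ) τ) (fun τ => C.piecewise (σ * τ) τ)
      (by simp) (by simp) ?_ ?_ ?_
    · intro τ _
      ext v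
      by_cases hv : v ∈ C <;> simp [hv, ← mul_assoc]
    · intro τ _
      ext v
      by_cases hv : v ∈ C <;> simp [hv, ← mul_assoc]
    · intro τ _
      have h2 : (∀ v ∈ C, C.piecewise (σ * τ) τ v = -1) ↔ C ⊆ disagreement σ τ := by
        refine forall₂_congr fun v hv => ?_
        rw [mem_disagreement, Finset.piecewise_eq_of_mem _ _ _ hv, Pi.mul_apply]
        rcases Int.units_eq_one_or (σ v) with h | h <;>
          rcases Int.units_eq_one_or (τ v) with h' | h' <;> simp [h, h']
      simp only [h2]
      rw [hg (C.piecewise (σ * τ) τ) τ fun v hv => by simp [hv]]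
      split_ifs <;> simp
  rw [h1, card_mul_sum_mul_eq C _ _ ?_ hg]
  · simp
  · intro σ τ h
    have : (∀ v ∈ C, σ v = -1) ↔ ∀ v ∈ C, τ v = -1 :=
      forall₂_congr fun v hv => by rw [h v hv]
    simp only [this]

/-- The contribution of a cluster `C` to `corr_mul_sub` factorizes. -/
lemma sum_cluster_eq (C : Finset V) (p f : SpinConfig V → ℝ)
    (hp : ∀ σ τ : SpinConfig V, (∀ v ∈ C, σ v = τ v) → p σ = p τ)
    (hf : ∀ σ τ : SpinConfig V, (∀ v ∉ C, σ v = τ v) → f σ = f τ) :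
    (∑ σ, ∑ τ, if C ⊆ disagreement σ τ then
      algebraMap ℝ R (p σ * f σ) *
      ((algebraMap ℝ R (bondWeight (decouple K C) σ) *
        sourceFactor y s (B.filter fun i => s i ∉ C) σ) *
       (algebraMap ℝ R (bondWeight (decouple K C) τ) *
        sourceFactor y s (B.filter fun i => s i ∉ C) τ)) else 0) =
    algebraMap ℝ R ((∑ σ, p σ) *
      ((Finset.univ.filter fun τ : SpinConfig V => ∀ v ∈ C, τ v = -1).card /
        (Fintype.card (SpinConfig V) : ℝ) ^ 2)) *
      (corr (decouple K C) y s (B.filter fun i => s i ∉ C) f *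
        corr (decouple K C) y s (B.filter fun i => s i ∉ C) 1) := by
  set B' := B.filter fun i => s i ∉ C
  set N : ℝ := ((Finset.univ.filter fun τ : SpinConfig V => ∀ v ∈ C, τ v = -1).card : ℝ) with hN
  set M : ℝ := (Fintype.card (SpinConfig V) : ℝ) with hM
  have hM0 : M ≠ 0 := by
    rw [hM]; exact_mod_cast Fintype.card_ne_zero
  have hu : algebraMap ℝ R (M⁻¹) * algebraMap ℝ R M = 1 := by
    rw [← map_mul, inv_mul_cancel₀ hM0, map_one]
  have hMR : (Fintype.card (SpinConfig V) : R) = algebraMap ℝ R M := (map_natCast _ _).symm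
  set g : SpinConfig V → R := fun τ =>
    algebraMap ℝ R (bondWeight (decouple K C) τ) * sourceFactor y s B' τ with hgdef
  have hg : ∀ σ τ : SpinConfig V, (∀ v ∉ C, σ v = τ v) → g σ = g τ := fun σ τ h => by
    simp only [hgdef]
    rw [bondWeight_decouple_congr K h, sourceFactor_filter_congr y s B h]
  have hZ : corr (decouple K C) y s B' 1 = ∑ τ, g τ := by simp [corr, hgdef]
  have hZf : corr (decouple K C) y s B' f = ∑ σ, algebraMap ℝ R (f σ) * g σ := by
    simp [corr, hgdef, mul_assoc]
  have h1 : ∀ σ, algebraMap ℝ R M * ∑ τ, (if C ⊆ disagreement σ τ then g τ else 0) =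
      algebraMap ℝ R N * ∑ τ, g τ := fun σ => by
    rw [← hMR, sum_disagreement C σ g hg]; simp [hN]
  have h2 : algebraMap ℝ R M * ∑ σ, algebraMap ℝ R (p σ) * (algebraMap ℝ R (f σ) * g σ) =
      (∑ σ, algebraMap ℝ R (p σ)) * ∑ σ, algebraMap ℝ R (f σ) * g σ := by
    rw [← hMR]
    refine card_mul_sum_mul_eq C _ _ (fun σ τ h => by rw [hp σ τ h]) fun σ τ h => ?_
    rw [hf σ τ h, hg σ τ h]
  have h3 : ∀ σ, (∑ τ, if C ⊆ disagreement σ τ then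
      algebraMap ℝ R (p σ * f σ) * (g σ * g τ) else 0) =
      algebraMap ℝ R (p σ) * (algebraMap ℝ R (f σ) * g σ) *
        ∑ τ, (if C ⊆ disagreement σ τ then g τ else 0) := fun σ => by
    rw [Finset.mul_sum]
    refine Finset.sum_congr rfl fun τ _ => ?_
    split_ifs
    · rw [map_mul]; ring
    · simp
  have h4 : ∀ σ, ∑ τ, (if C ⊆ disagreement σ τ then g τ else 0) =
      algebraMap ℝ R M⁻¹ * (algebraMap ℝ R N * ∑ τ, g τ) := fun σ => by
    rw [← h1 σ, ← mul_assoc, hu, one_mul]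
  have h5 : ∑ σ, algebraMap ℝ R (p σ) * (algebraMap ℝ R (f σ) * g σ) = algebraMap ℝ R M⁻¹ *
      ((∑ σ, algebraMap ℝ R (p σ)) * ∑ σ, algebraMap ℝ R (f σ) * g σ) := by
    rw [← h2, ← mul_assoc, hu, one_mul]
  rw [hZ, hZf]
  change (∑ σ, ∑ τ, if C ⊆ disagreement σ τ then
    algebraMap ℝ R (p σ * f σ) * (g σ * g τ) else 0) = _
  simp only [h3, h4]
  rw [← Finset.sum_mul, h5, div_eq_mul_inv, ← inv_pow]
  simp only [map_mul, map_pow, map_sum]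
  ring

/-! ### Parity and sign of cluster contributions; truncated two- and three-point functions -/

lemma sum_clusterWeight_mul_eq_zero {C : Finset V} (w : V) (f : SpinConfig V → ℝ)
    (hK : ∀ p, 0 ≤ K p)
    (hf : ∀ σ τ : SpinConfig V, (∀ v ∈ C, τ v = -σ v) → f τ = f σ) :
    ∑ σ, 2 * (clusterWeight (fun p => 2 * K p) {w} C σ * spin w σ) * f σ = 0 := by
  by_cases hw : w ∈ C
  · have h : ∑ σ, 2 * (clusterWeight (fun p => 2 * K p) {w} C σ * spin w σ) * f σ =
        ∑ σ, -(2 * (clusterWeight (fun p => 2 * K p) {w} C σ * spin w σ) * f σ) := by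
      refine Fintype.sum_equiv (Equiv.neg _) _ _ fun σ => ?_
      have h1 := evenCone.apply_neg
        (clusterWeight_mem (fun p => 2 * K p) (fun p => by have := hK p; positivity) {w} C)
        (σ := σ) (τ := -σ) (fun v _ => rfl)
      have h2 : spin w (-σ) = -spin w σ := spin_neg rfl
      simp only [Equiv.neg_apply, h1, h2, hf σ (-σ) (fun v _ => rfl)]
      ring
    rw [Finset.sum_neg_distrib] at h
    linarith
  · refine Finset.sum_eq_zero fun σ _ => ?_
    rw [clusterWeight_eq_zero _ (by simpa using hw)]
    simp

lemma sum_clusterWeight_mul_spin_nonneg {C : Finset V} (w : V) {v : V} (hv : v ∈ C)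
    (hK : ∀ p, 0 ≤ K p) :
    0 ≤ ∑ σ, 2 * (clusterWeight (fun p => 2 * K p) {w} C σ * spin w σ) * spin v σ := by
  by_cases hw : w ∈ C
  · have h := evenCone.sum_nonneg (mul_mem (mul_mem (evenCone.const_mem C zero_le_two)
      (clusterWeight_mem (fun p => 2 * K p) (fun p => by have := hK p; positivity) {w} C))
      (evenCone.pair_mem hw hv))
    convert h using 2 with σ
    simp only [Pi.mul_apply]
    ring
  · refine (Finset.sum_eq_zero fun σ _ => ?_).ge
    rw [clusterWeight_eq_zero _ (by simpa using hw)]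
    simp

lemma clusterWeight_mul_spin_congr {C : Finset V} (w : V) (hK : ∀ p, 0 ≤ K p)
    {σ τ : SpinConfig V} (h : ∀ v ∈ C, σ v = τ v) :
    clusterWeight (fun p => 2 * K p) {w} C σ * spin w σ =
      clusterWeight (fun p => 2 * K p) {w} C τ * spin w τ := by
  by_cases hw : w ∈ C
  · rw [spin_congr (h w hw), evenCone.apply_congr
      (clusterWeight_mem (fun p => 2 * K p) (fun p => by have := hK p; positivity) {w} C) h]
  · simp [clusterWeight_eq_zero (fun p => 2 * K p) (A := {w}) (C := C) (by simpa using hw)]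

/-- If `f` splits into a factor `f₁` on `C` and a factor `f₂` off `C`, the contribution of `C`. -/
lemma sum_cluster_mul_eq {C : Finset V} (w : V) (f f₁ f₂ : SpinConfig V → ℝ) (hK : ∀ p, 0 ≤ K p)
    (hff : ∀ σ, f σ = f₁ σ * f₂ σ)
    (hf₁ : ∀ σ τ : SpinConfig V, (∀ v ∈ C, σ v = τ v) → f₁ σ = f₁ τ)
    (hf₂ : ∀ σ τ : SpinConfig V, (∀ v ∉ C, σ v = τ v) → f₂ σ = f₂ τ) :
    (∑ σ, ∑ τ, if C ⊆ disagreement σ τ then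
      algebraMap ℝ R (2 * f σ * (clusterWeight (fun p => 2 * K p) {w} C σ * spin w σ)) *
      ((algebraMap ℝ R (bondWeight (decouple K C) σ) *
        sourceFactor y s (B.filter fun i => s i ∉ C) σ) *
       (algebraMap ℝ R (bondWeight (decouple K C) τ) *
        sourceFactor y s (B.filter fun i => s i ∉ C) τ)) else 0) =
    algebraMap ℝ R ((∑ σ, 2 * (clusterWeight (fun p => 2 * K p) {w} C σ * spin w σ) * f₁ σ) *
      ((Finset.univ.filter fun τ : SpinConfig V => ∀ v ∈ C, τ v = -1).card /
        (Fintype.card (SpinConfig V) : ℝ) ^ 2)) *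
      (corr (decouple K C) y s (B.filter fun i => s i ∉ C) f₂ *
        corr (decouple K C) y s (B.filter fun i => s i ∉ C) 1) := by
  rw [← sum_cluster_eq K y s B C
    (fun σ => 2 * (clusterWeight (fun p => 2 * K p) {w} C σ * spin w σ) * f₁ σ) f₂ ?_ hf₂]
  · refine Finset.sum_congr rfl fun σ _ => Finset.sum_congr rfl fun τ _ => ?_
    rw [hff σ, show 2 * (f₁ σ * f₂ σ) * (clusterWeight (fun p => 2 * K p) {w} C σ * spin w σ) =
      2 * (clusterWeight (fun p => 2 * K p) {w} C σ * spin w σ) * f₁ σ * f₂ σ by ring]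
  · intro σ τ h
    simp only [clusterWeight_mul_spin_congr K w hK h, hf₁ σ τ h]

/-- A cluster of w missing v carries an odd function on C and drops out. If v lies in C, the factor
on C is nonnegative by Griffiths' inequality, and both copies are left with the partition function
off C. -/
lemma exists_two_point_truncated (hK : ∀ p, 0 ≤ K p) (hy : ∀ i, y i * y i = 0) (v w : V) :
    ∃ k : Finset V → ℝ, (∀ C, 0 ≤ k C) ∧
      corr K y s B (fun σ => spin v σ * spin w σ) * corr K y s B 1 -
        corr K y s B (spin v) * corr K y s B (spin w) =
      ∑ C, algebraMap ℝ R (k C) *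
        (corr (decouple K C) y s (B.filter fun i => s i ∉ C) 1 *
          corr (decouple K C) y s (B.filter fun i => s i ∉ C) 1) := by
  have h : ∀ C : Finset V, ∃ k : ℝ, 0 ≤ k ∧
    (∑ σ, ∑ τ, if C ⊆ disagreement σ τ then
      algebraMap ℝ R (2 * spin v σ * (clusterWeight (fun p => 2 * K p) {w} C σ * spin w σ)) *
      ((algebraMap ℝ R (bondWeight (decouple K C) σ) *
        sourceFactor y s (B.filter fun i => s i ∉ C) σ) *
       (algebraMap ℝ R (bondWeight (decouple K C) τ) *
        sourceFactor y s (B.filter fun i => s i ∉ C) τ)) else 0) = algebraMap ℝ R k *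
        (corr (decouple K C) y s (B.filter fun i => s i ∉ C) 1 *
          corr (decouple K C) y s (B.filter fun i => s i ∉ C) 1) := by
    intro C
    by_cases hv : v ∈ C
    · rw [sum_cluster_mul_eq K y s B w (spin v) (spin v) 1 hK (by simp)
        (fun σ τ h => spin_congr (h v hv)) (fun _ _ _ => rfl)]
      exact ⟨_, mul_nonneg (sum_clusterWeight_mul_spin_nonneg K w hv hK)
          (div_nonneg (Nat.cast_nonneg _) (sq_nonneg _)), rfl⟩
    · rw [sum_cluster_mul_eq K y s B w (spin v) 1 (spin v) hK (by simp)
        (fun _ _ _ => rfl) (fun σ τ h => spin_congr (h v hv)),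
        sum_clusterWeight_mul_eq_zero K w 1 hK (fun _ _ _ => rfl)]
      exact ⟨0, le_rfl, by simp⟩
  choose k hk hk' using h
  refine ⟨k, hk, ?_⟩
  rw [corr_mul_sub K y s B w _ hy]
  exact Finset.sum_congr rfl fun C _ => hk' C

/-- By parity only clusters containing exactly one of u, v contribute; the other spin is left as a
one-point function of the decoupled system. -/
lemma exists_three_point_truncated (hK : ∀ p, 0 ≤ K p) (hy : ∀ i, y i * y i = 0) (u v w : V) :
    ∃ k l : Finset V → ℝ, (∀ C, 0 ≤ k C) ∧ (∀ C, 0 ≤ l C) ∧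
      corr K y s B (fun σ => spin u σ * spin v σ * spin w σ) * corr K y s B 1 -
        corr K y s B (fun σ => spin u σ * spin v σ) * corr K y s B (spin w) =
      ∑ C, (algebraMap ℝ R (k C) *
        (corr (decouple K C) y s (B.filter fun i => s i ∉ C) (spin u) *
          corr (decouple K C) y s (B.filter fun i => s i ∉ C) 1) +
        algebraMap ℝ R (l C) *
        (corr (decouple K C) y s (B.filter fun i => s i ∉ C) (spin v) *
          corr (decouple K C) y s (B.filter fun i => s i ∉ C) 1)) := by
  have h : ∀ C : Finset V, ∃ k l : ℝ, 0 ≤ k ∧ 0 ≤ l ∧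
    (∑ σ, ∑ τ, if C ⊆ disagreement σ τ then
      algebraMap ℝ R (2 * (spin u σ * spin v σ) *
        (clusterWeight (fun p => 2 * K p) {w} C σ * spin w σ)) *
      ((algebraMap ℝ R (bondWeight (decouple K C) σ) *
        sourceFactor y s (B.filter fun i => s i ∉ C) σ) *
       (algebraMap ℝ R (bondWeight (decouple K C) τ) *
        sourceFactor y s (B.filter fun i => s i ∉ C) τ)) else 0) = algebraMap ℝ R k *
        (corr (decouple K C) y s (B.filter fun i => s i ∉ C) (spin u) *
          corr (decouple K C) y s (B.filter fun i => s i ∉ C) 1) + algebraMap ℝ R l *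
        (corr (decouple K C) y s (B.filter fun i => s i ∉ C) (spin v) *
          corr (decouple K C) y s (B.filter fun i => s i ∉ C) 1) := by
    intro C
    by_cases hu : u ∈ C <;> by_cases hv : v ∈ C
    · rw [sum_cluster_mul_eq K y s B w _ (fun σ => spin u σ * spin v σ) 1 hK (by simp)
        (fun σ τ h => by rw [spin_congr (h u hu), spin_congr (h v hv)]) (fun _ _ _ => rfl),
        sum_clusterWeight_mul_eq_zero K w _ hK
          (fun σ τ h => by rw [spin_neg (h u hu), spin_neg (h v hv), neg_mul_neg])]
      exact ⟨0, 0, le_rfl, le_rfl, by simp⟩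
    · rw [sum_cluster_mul_eq K y s B w _ (spin u) (spin v) hK (fun _ => rfl)
        (fun σ τ h => spin_congr (h u hu)) (fun σ τ h => spin_congr (h v hv))]
      exact ⟨0, _, le_rfl,
        mul_nonneg (sum_clusterWeight_mul_spin_nonneg K w hu hK)
          (div_nonneg (Nat.cast_nonneg _) (sq_nonneg _)),
        by rw [map_zero, zero_mul, zero_add]⟩
    · rw [sum_cluster_mul_eq K y s B w _ (spin v) (spin u) hK (fun _ => mul_comm _ _)
        (fun σ τ h => spin_congr (h v hv)) (fun σ τ h => spin_congr (h u hu))]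
      exact ⟨_, 0, mul_nonneg (sum_clusterWeight_mul_spin_nonneg K w hv hK)
          (div_nonneg (Nat.cast_nonneg _) (sq_nonneg _)),
        le_rfl, by rw [map_zero, zero_mul, add_zero]⟩
    · rw [sum_cluster_mul_eq K y s B w _ 1 (fun σ => spin u σ * spin v σ) hK (by simp)
        (fun _ _ _ => rfl) (fun σ τ h => by rw [spin_congr (h u hu), spin_congr (h v hv)]),
        sum_clusterWeight_mul_eq_zero K w 1 hK (fun _ _ _ => rfl)]
      exact ⟨0, 0, le_rfl, le_rfl, by simp⟩
  choose k l hk hl hkl using h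
  refine ⟨k, l, hk, hl, ?_⟩
  rw [corr_mul_sub K y s B w _ hy]
  exact Finset.sum_congr rfl fun C _ => hkl C

end Correlations

/-! ### Positivity of the expansions in imaginary sources -/

section Positivity

variable {V : Type*} [Fintype V] [DecidableEq V]
variable {ι R : Type*} [DecidableEq ι] [CommRing R] [Algebra ℝ R]

/-! ### Dependence of correlations on a single source or coupling -/

section General

variable (K : V × V → ℝ) (y : ι → R) (s : ι → V) (B : Finset ι)

lemma corr_insert {i : ι} (hi : i ∉ B) (f : SpinConfig V → ℝ) :
    corr K y s (insert i B) f =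
      corr K y s B f + y i * corr K y s B (fun σ => f σ * spin (s i) σ) := by
  simp only [corr, sourceFactor, Finset.prod_insert hi, Finset.mul_sum, ← Finset.sum_add_distrib]
  refine Finset.sum_congr rfl fun σ _ => ?_
  simp only [map_mul]
  ring

lemma corr_empty (f : SpinConfig V → ℝ) :
    corr K y s ∅ f = algebraMap ℝ R (∑ σ, f σ * bondWeight K σ) := by
  simp [corr, sourceFactor]

lemma bondWeight_sum_pos : 0 < ∑ σ, bondWeight K σ :=
  Finset.sum_pos (fun _ _ => Real.exp_pos _) Finset.univ_nonempty

/-- Each source adds a nilpotent to the positive constant of the sourceless system. Invertibility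
permits cancelling Z in the induction. -/
lemma isUnit_corr_one (hy : ∀ i, y i * y i = 0) : IsUnit (corr K y s B 1) := by
  induction B using Finset.induction_on with
  | empty =>
    rw [corr_empty]
    refine IsUnit.map _ (IsUnit.mk0 _ ?_)
    simpa using (bondWeight_sum_pos K).ne'
  | insert i B hi ih =>
    rw [corr_insert K y s B hi]
    refine IsNilpotent.isUnit_add_left_of_commute ?_ ih (Commute.all _ _)
    refine (Commute.all _ _).isNilpotent_mul_right ⟨2, ?_⟩
    rw [sq, hy]

lemma bondWeight_eq_update (p : V × V) (σ : SpinConfig V) :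
    bondWeight K σ = (Real.cosh (K p) + Real.sinh (K p) * (spin p.1 σ * spin p.2 σ)) *
      bondWeight (Function.update K p 0) σ := by
  have h1 : ∀ K : V × V → ℝ, bondWeight K σ = Real.exp (K p * (spin p.1 σ * spin p.2 σ)) *
      Real.exp (∑ q ∈ Finset.univ.erase p, K q * (spin q.1 σ * spin q.2 σ)) := fun K => by
    rw [bondWeight, ← Finset.add_sum_erase _ _ (Finset.mem_univ p), Real.exp_add]
  have h2 : Real.exp (K p * (spin p.1 σ * spin p.2 σ)) =
      Real.cosh (K p) + Real.sinh (K p) * (spin p.1 σ * spin p.2 σ) := by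
    have hc := Real.cosh_add_sinh (K p)
    have hs := Real.cosh_sub_sinh (K p)
    rcases spin_eq_or p.1 σ with h | h <;> rcases spin_eq_or p.2 σ with h' | h' <;>
      simp [h, h'] <;> linarith
  rw [h1 K, h1 (Function.update K p 0), h2]
  have h3 : ∑ q ∈ Finset.univ.erase p, Function.update K p 0 q * (spin q.1 σ * spin q.2 σ) =
      ∑ q ∈ Finset.univ.erase p, K q * (spin q.1 σ * spin q.2 σ) :=
    Finset.sum_congr rfl fun q hq => by
      rw [Function.update_of_ne (Finset.ne_of_mem_erase hq)]
  rw [h3]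
  simp

lemma corr_eq_update (p : V × V) :
    corr K y s B 1 = algebraMap ℝ R (Real.cosh (K p)) * corr (Function.update K p 0) y s B 1 +
      algebraMap ℝ R (Real.sinh (K p)) *
        corr (Function.update K p 0) y s B (fun σ => spin p.1 σ * spin p.2 σ) := by
  simp only [corr, Finset.mul_sum, ← Finset.sum_add_distrib]
  refine Finset.sum_congr rfl fun σ _ => ?_
  rw [bondWeight_eq_update K p σ]
  simp only [map_mul, map_add, Pi.one_apply, map_one]
  ring

lemma sum_spin_mul_bondWeight (w : V) : ∑ σ, spin w σ * bondWeight K σ = 0 := by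
  have h : ∑ σ, spin w σ * bondWeight K σ = ∑ σ, -(spin w σ * bondWeight K σ) := by
    refine Fintype.sum_equiv (Equiv.neg _) _ _ fun σ => ?_
    have h1 : ∀ v, spin v (-σ) = -spin v σ := fun v => spin_neg rfl
    simp only [Equiv.neg_apply, bondWeight, h1]
    simp
  rw [Finset.sum_neg_distrib] at h
  linarith

lemma sum_pair_mul_bondWeight_nonneg (hK : ∀ p, 0 ≤ K p) (u v : V) :
    0 ≤ ∑ σ, spin u σ * spin v σ * bondWeight K σ :=
  evenCone.sum_nonneg (mul_mem (evenCone.pair_mem (Finset.mem_univ u) (Finset.mem_univ v))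
    (evenCone.exp_sum_mem Finset.univ K Prod.fst Prod.snd (fun p _ => hK p)
      (fun _ _ => Finset.mem_univ _) (fun _ _ => Finset.mem_univ _)))

end General

/-- A semiring of nonnegative elements of a real algebra with an imaginary unit, together with
nonnegative elements of square zero. -/
structure ImaginarySources (P : Subsemiring R) (I : R) (x : ι → R) : Prop where
  sq_I : I * I = -1
  algebraMap_mem : ∀ r : ℝ, 0 ≤ r → algebraMap ℝ R r ∈ P
  mem : ∀ i, x i ∈ P
  sq_zero : ∀ i, x i * x i = 0

/-- The inverse of r - n is the finite geometric series of n^i / r^(i+1), which involves no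
subtraction. -/
lemma exists_mem_mul_sub_eq_one {P : Subsemiring R}
    (hP : ∀ r : ℝ, 0 ≤ r → algebraMap ℝ R r ∈ P) {r : ℝ} (hr : 0 < r) {n : R} (hn : n ∈ P)
    (hnil : IsNilpotent n) : ∃ q ∈ P, q * (algebraMap ℝ R r - n) = 1 := by
  obtain ⟨k, hk⟩ := hnil
  have ha : algebraMap ℝ R r⁻¹ ∈ P := hP _ (inv_nonneg.2 hr.le)
  have hu : algebraMap ℝ R r⁻¹ * algebraMap ℝ R r = 1 := by
    rw [← map_mul, inv_mul_cancel₀ hr.ne', map_one]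
  refine ⟨(∑ i ∈ Finset.range k, (algebraMap ℝ R r⁻¹ * n) ^ i) * algebraMap ℝ R r⁻¹,
    mul_mem (sum_mem fun i _ => pow_mem (mul_mem ha hn) i) ha, ?_⟩
  rw [mul_assoc, mul_sub, hu, geom_sum_mul_neg, mul_pow, hk, mul_zero, sub_zero]

/-- The expansion of the magnetization in imaginary sources is `I` times a nonnegative one. -/
def MagnetizationPos (P : Subsemiring R) (I : R) (x : ι → R) (s : ι → V) (B : Finset ι) : Prop :=
  ∀ K : V × V → ℝ, (∀ p, 0 ≤ K p) → ∀ w, ∃ m ∈ P,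
    corr K (fun i => I * x i) s B (spin w) = I * m * corr K (fun i => I * x i) s B 1

/-- The expansion of a pair correlation in imaginary sources is nonpositive except for its
constant term. -/
def PairCorrNeg (P : Subsemiring R) (I : R) (x : ι → R) (s : ι → V) (B : Finset ι) : Prop :=
  ∀ K : V × V → ℝ, (∀ p, 0 ≤ K p) → ∀ u v, ∃ r : ℝ, 0 ≤ r ∧ ∃ n ∈ P, IsNilpotent n ∧
    corr K (fun i => I * x i) s B (fun σ => spin u σ * spin v σ) =
      (algebraMap ℝ R r - n) * corr K (fun i => I * x i) s B 1

variable {P : Subsemiring R} {I : R} {x : ι → R} {s : ι → V} {B : Finset ι}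

/-! ### Nonnegative ratios of partition functions and the induction on the sources -/

lemma decouple_nonneg {K : V × V → ℝ} (hK : ∀ p, 0 ≤ K p) (C : Finset V) (p : V × V) :
    0 ≤ decouple K C p := by
  unfold decouple
  split_ifs
  · exact le_rfl
  · exact hK p

namespace ImaginarySources

variable (h : ImaginarySources P I x)
include h

lemma sq_mul_zero (i : ι) : I * x i * (I * x i) = 0 := by
  linear_combination (I * I) * h.sq_zero i

/-- Switching on the coupling of p multiplies Z by cosh + sinh · (r - n), with r - n the pair
correlation without it: a positive constant minus a nonnegative nilpotent. -/
lemma exists_ratio_update (hB : PairCorrNeg P I x s B) {K : V × V → ℝ} (hK : ∀ p, 0 ≤ K p)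
    (p : V × V) : ∃ q ∈ P, corr (Function.update K p 0) (fun i => I * x i) s B 1 =
      q * corr K (fun i => I * x i) s B 1 := by
  have hK0 : ∀ q, 0 ≤ Function.update K p 0 q := fun q => by
    rcases eq_or_ne q p with rfl | hq
    · simp
    · rw [Function.update_of_ne hq]; exact hK q
  obtain ⟨r, hr, n, hn, hnil, e⟩ := hB _ hK0 p.1 p.2
  have hs : 0 ≤ Real.sinh (K p) := Real.sinh_nonneg_iff.2 (hK p)
  obtain ⟨q, hq, hq1⟩ := exists_mem_mul_sub_eq_one h.algebraMap_mem
    (r := Real.cosh (K p) + Real.sinh (K p) * r)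
    (add_pos_of_pos_of_nonneg (Real.cosh_pos _) (mul_nonneg hs hr))
    (mul_mem (h.algebraMap_mem _ hs) hn) ((Commute.all _ _).isNilpotent_mul_left hnil)
  refine ⟨q, hq, ?_⟩
  rw [corr_eq_update K _ s B p, e]
  rw [map_add, map_mul] at hq1
  linear_combination (-corr (Function.update K p 0) (fun i => I * x i) s B 1) * hq1

lemma exists_ratio_decouple (hB : PairCorrNeg P I x s B) {K : V × V → ℝ} (hK : ∀ p, 0 ≤ K p)
    (C : Finset V) : ∃ q ∈ P, corr (decouple K C) (fun i => I * x i) s B 1 =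
      q * corr K (fun i => I * x i) s B 1 := by
  have key : ∀ T : Finset (V × V), ∃ q ∈ P,
      corr (fun p => if p ∈ T then 0 else K p) (fun i => I * x i) s B 1 =
        q * corr K (fun i => I * x i) s B 1 := by
    intro T
    induction T using Finset.induction_on with
    | empty => exact ⟨1, one_mem _, by simp⟩
    | insert p T hp ih =>
      obtain ⟨q, hq, e⟩ := ih
      obtain ⟨q', hq', e'⟩ := h.exists_ratio_update hB
        (K := fun p => if p ∈ T then 0 else K p) (fun p => by split_ifs <;> simp [hK]) p
      refine ⟨q' * q, mul_mem hq' hq, ?_⟩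
      rw [mul_assoc, ← e, ← e']
      congr 1
      funext p'
      rcases eq_or_ne p' p with rfl | hne
      · simp
      · simp [hne]
  obtain ⟨q, hq, e⟩ := key (Finset.univ.filter fun p => p.1 ∈ C ∨ p.2 ∈ C)
  refine ⟨q, hq, ?_⟩
  rw [← e]
  congr 1
  funext p
  simp [decouple]

/-- A source multiplies Z by 1 + I x_i · I m = 1 - x_i m, whose inverse is 1 + x_i m because x_i² =
0. -/
lemma exists_ratio_sources (hB : ∀ B' ⊆ B, MagnetizationPos P I x s B') {K : V × V → ℝ}
    (hK : ∀ p, 0 ≤ K p) {B' : Finset ι} (hB' : B' ⊆ B) :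
    ∃ q ∈ P, corr K (fun i => I * x i) s B' 1 = q * corr K (fun i => I * x i) s B 1 := by
  have key : ∀ D : Finset ι, D ⊆ B \ B' → ∃ q ∈ P,
      corr K (fun i => I * x i) s B' 1 = q * corr K (fun i => I * x i) s (D ∪ B') 1 := by
    intro D
    induction D using Finset.induction_on with
    | empty => exact fun _ => ⟨1, one_mem _, by simp⟩
    | insert i D hi ih =>
      intro hD
      have hiB := Finset.mem_sdiff.1 (hD (Finset.mem_insert_self i D))
      have hDB : D ⊆ B \ B' := (Finset.subset_insert i D).trans hD
      obtain ⟨q, hq, e⟩ := ih hDB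
      obtain ⟨m, hm, e'⟩ := hB (D ∪ B')
        (Finset.union_subset (hDB.trans Finset.sdiff_subset) hB') K hK (s i)
      refine ⟨q * (1 + x i * m), mul_mem hq (add_mem (one_mem _) (mul_mem (h.mem i) hm)), ?_⟩
      have hi' : i ∉ D ∪ B' := by simp [hi, hiB.2]
      rw [Finset.insert_union, corr_insert K _ s _ hi', e]
      simp only [Pi.one_apply, one_mul]
      rw [e']
      set Z := corr K (fun i => I * x i) s (D ∪ B') 1
      linear_combination (-(q * (1 + x i * m) * x i * m * Z)) * h.sq_I +
        (q * m * m * Z) * h.sq_zero i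
  obtain ⟨q, hq, e⟩ := key (B \ B') le_rfl
  rw [Finset.sdiff_union_of_subset hB'] at e
  exact ⟨q, hq, e⟩

lemma exists_ratio (hM : ∀ B' ⊆ B, MagnetizationPos P I x s B') (hB : PairCorrNeg P I x s B)
    {K : V × V → ℝ} (hK : ∀ p, 0 ≤ K p) (C : Finset V) :
    ∃ q ∈ P, corr (decouple K C) (fun i => I * x i) s (B.filter fun i => s i ∉ C) 1 =
      q * corr K (fun i => I * x i) s B 1 := by
  obtain ⟨q, hq, e⟩ := h.exists_ratio_sources hM (decouple_nonneg hK C)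
    (Finset.filter_subset (fun i => s i ∉ C) B)
  obtain ⟨q', hq', e'⟩ := h.exists_ratio_decouple hB hK C
  exact ⟨q * q', mul_mem hq hq', by rw [e, e', mul_assoc]⟩

/-- The truncated two-point function is Q = ∑ k_C (Z_C/Z)², so the magnetization I m gains I x_i Q.
-/
lemma magnetizationPos_insert {i : ι} (hi : i ∉ B)
    (hM : ∀ B' ⊆ B, MagnetizationPos P I x s B') (hB : PairCorrNeg P I x s B) :
    MagnetizationPos P I x s (insert i B) := by
  intro K hK w
  obtain ⟨m, hm, em⟩ := hM B le_rfl K hK w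
  obtain ⟨k, hk, ek⟩ := exists_two_point_truncated K (fun i => I * x i) s B hK h.sq_mul_zero w (s i)
  choose q hq eq using h.exists_ratio hM hB hK
  set Z := corr K (fun i => I * x i) s B 1 with hZ
  have hu : IsUnit Z := isUnit_corr_one K _ s B h.sq_mul_zero
  set Q := ∑ C, algebraMap ℝ R (k C) * (q C * q C) with hQ
  have hQP : Q ∈ P := sum_mem fun C _ =>
    mul_mem (h.algebraMap_mem _ (hk C)) (mul_mem (hq C) (hq C))
  have e1 : ∑ C, algebraMap ℝ R (k C) *
      (corr (decouple K C) (fun i => I * x i) s (B.filter fun i => s i ∉ C) 1 *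
        corr (decouple K C) (fun i => I * x i) s (B.filter fun i => s i ∉ C) 1) = Q * Z * Z := by
    rw [hQ, Finset.sum_mul, Finset.sum_mul]
    refine Finset.sum_congr rfl fun C _ => ?_
    rw [eq C]
    ring
  rw [e1, em] at ek
  have e2 : corr K (fun i => I * x i) s B (fun σ => spin w σ * spin (s i) σ) =
      Q * Z + I * m * corr K (fun i => I * x i) s B (spin (s i)) :=
    hu.mul_right_cancel (by linear_combination ek)
  refine ⟨m + x i * Q, add_mem hm (mul_mem (h.mem i) hQP), ?_⟩
  rw [corr_insert K _ s B hi, corr_insert K _ s B hi, em, e2]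
  simp only [Pi.one_apply, one_mul]
  linear_combination (-(I * I * Q * corr K (fun i => I * x i) s B (spin (s i)))) * h.sq_zero i

/-- Every term of the truncated three-point function has one magnetization of a decoupled system,
hence one I; with the I of the new source this makes the increment -x_i Q. -/
lemma pairCorrNeg_insert {i : ι} (hi : i ∉ B)
    (hM : ∀ B' ⊆ B, MagnetizationPos P I x s B') (hB : PairCorrNeg P I x s B) :
    PairCorrNeg P I x s (insert i B) := by
  intro K hK u v
  obtain ⟨r, hr, n, hn, hnil, en⟩ := hB K hK u v
  obtain ⟨k, l, hk, hl, ek⟩ :=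
    exists_three_point_truncated K (fun i => I * x i) s B hK h.sq_mul_zero u v (s i)
  choose q hq eq using h.exists_ratio hM hB hK
  choose m hm em using fun C => hM _ (Finset.filter_subset (fun i => s i ∉ C) B)
    (decouple K C) (decouple_nonneg hK C)
  set Z := corr K (fun i => I * x i) s B 1 with hZ
  have hu : IsUnit Z := isUnit_corr_one K _ s B h.sq_mul_zero
  set Q := ∑ C, (algebraMap ℝ R (k C) * (m C u * (q C * q C)) +
    algebraMap ℝ R (l C) * (m C v * (q C * q C))) with hQ
  have hQP : Q ∈ P := sum_mem fun C _ => add_mem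
    (mul_mem (h.algebraMap_mem _ (hk C)) (mul_mem (hm C u) (mul_mem (hq C) (hq C))))
    (mul_mem (h.algebraMap_mem _ (hl C)) (mul_mem (hm C v) (mul_mem (hq C) (hq C))))
  have e1 : corr K (fun i => I * x i) s B (fun σ => spin u σ * spin v σ * spin (s i) σ) * Z -
      corr K (fun i => I * x i) s B (fun σ => spin u σ * spin v σ) *
        corr K (fun i => I * x i) s B (spin (s i)) = I * Q * Z * Z := by
    rw [ek, hQ, Finset.mul_sum, Finset.sum_mul, Finset.sum_mul]
    refine Finset.sum_congr rfl fun C _ => ?_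
    rw [em C u, em C v, eq C]
    ring
  rw [en] at e1
  have e2 : corr K (fun i => I * x i) s B (fun σ => spin u σ * spin v σ * spin (s i) σ) =
      I * Q * Z + (algebraMap ℝ R r - n) * corr K (fun i => I * x i) s B (spin (s i)) :=
    hu.mul_right_cancel (by linear_combination e1)
  refine ⟨r, hr, n + x i * Q, add_mem hn (mul_mem (h.mem i) hQP), ?_, ?_⟩
  · refine (Commute.all _ _).isNilpotent_add hnil ((Commute.all _ _).isNilpotent_mul_right ⟨2, ?_⟩)
    rw [sq, h.sq_zero]
  · rw [corr_insert K _ s B hi, corr_insert K _ s B hi, en, e2]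
    simp only [Pi.one_apply, one_mul]
    linear_combination (Q * x i * Z) * h.sq_I +
      (I * Q * corr K (fun i => I * x i) s B (spin (s i))) * h.sq_zero i

/-- Both statements are needed for all smaller source sets, since decoupling C deletes the sources
on C. Without sources, spin-flip symmetry and Griffiths' inequality suffice. -/
theorem positivity (s : ι → V) (B : Finset ι) :
    MagnetizationPos P I x s B ∧ PairCorrNeg P I x s B := by
  induction B using Finset.strongInduction with
  | _ B ih =>
    rcases B.eq_empty_or_nonempty with rfl | ⟨i, hi⟩
    · refine ⟨fun K hK w => ⟨0, zero_mem _, ?_⟩, fun K hK u v => ?_⟩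
      · rw [corr_empty, sum_spin_mul_bondWeight]
        simp
      · have hpos := bondWeight_sum_pos K
        refine ⟨(∑ σ, spin u σ * spin v σ * bondWeight K σ) / ∑ σ, bondWeight K σ,
          div_nonneg (sum_pair_mul_bondWeight_nonneg K hK u v) hpos.le, 0, zero_mem _,
          IsNilpotent.zero, ?_⟩
        rw [corr_empty, corr_empty, sub_zero, ← map_mul]
        simp only [Pi.one_apply, one_mul]
        rw [div_mul_cancel₀ _ hpos.ne']
    · have hsub : ∀ B' ⊆ B.erase i, MagnetizationPos P I x s B' ∧ PairCorrNeg P I x s B' :=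
        fun B' hB' => ih B' (lt_of_le_of_lt hB' (Finset.erase_ssubset hi))
      rw [← Finset.insert_erase hi]
      exact ⟨h.magnetizationPos_insert (Finset.notMem_erase i B) (fun B' hB' => (hsub B' hB').1)
          (hsub _ le_rfl).2,
        h.pairCorrNeg_insert (Finset.notMem_erase i B) (fun B' hB' => (hsub B' hB').1)
          (hsub _ le_rfl).2⟩

end ImaginarySources

end Positivity

/-! ### The algebra of set functions with the subset convolution -/

/-- Complex-valued functions on the finite subsets of `ι`, with the product
`(f * g) A = ∑ B ⊆ A, f B * g (A \ B)`. -/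
@[ext] structure SetAlgebra (ι : Type*) where
  /-- The values of the set function. -/
  coeff : Finset ι → ℂ

namespace SetAlgebra

variable {ι : Type*} [DecidableEq ι]

instance : CoeFun (SetAlgebra ι) (fun _ => Finset ι → ℂ) := ⟨coeff⟩

/-- Set functions as functions on finite sets. -/
def equivFun (ι : Type*) : SetAlgebra ι ≃ (Finset ι → ℂ) := ⟨coeff, mk, fun _ => rfl, fun _ => rfl⟩

instance : AddCommGroup (SetAlgebra ι) := (equivFun ι).addCommGroup

lemma ext_apply {f g : SetAlgebra ι} (h : ∀ A, f A = g A) : f = g := SetAlgebra.ext (funext h)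

/-- The set function with value `c` at `A` and `0` elsewhere. -/
def single (A : Finset ι) (c : ℂ) : SetAlgebra ι := ⟨fun B => if B = A then c else 0⟩

lemma single_apply (A B : Finset ι) (c : ℂ) : single A c B = if B = A then c else 0 := rfl

instance : Mul (SetAlgebra ι) := ⟨fun f g => ⟨fun A => ∑ B ∈ A.powerset, f B * g (A \ B)⟩⟩

instance : One (SetAlgebra ι) := ⟨single ∅ 1⟩

lemma coeff_mul (f g : SetAlgebra ι) (A : Finset ι) :
    (f * g) A = ∑ B ∈ A.powerset, f B * g (A \ B) := rfl

lemma coeff_one (A : Finset ι) : (1 : SetAlgebra ι) A = if A = ∅ then 1 else 0 := rfl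

@[simp] lemma coeff_add (f g : SetAlgebra ι) (A : Finset ι) : (f + g) A = f A + g A := rfl

@[simp] lemma coeff_zero (A : Finset ι) : (0 : SetAlgebra ι) A = 0 := rfl

@[simp] lemma coeff_sub (f g : SetAlgebra ι) (A : Finset ι) : (f - g) A = f A - g A := rfl

@[simp] lemma coeff_sum {β : Type*} (t : Finset β) (f : β → SetAlgebra ι) (A : Finset ι) :
    (∑ b ∈ t, f b) A = ∑ b ∈ t, f b A :=
  map_sum (⟨⟨fun f => f A, rfl⟩, fun _ _ => rfl⟩ : SetAlgebra ι →+ ℂ) f t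

lemma single_mul_apply (A : Finset ι) (c : ℂ) (f : SetAlgebra ι) (B : Finset ι) :
    (single A c * f) B = if A ⊆ B then c * f (B \ A) else 0 := by
  rw [coeff_mul]
  split_ifs with h
  · rw [Finset.sum_eq_single A]
    · simp [single_apply]
    · intro C _ hC
      simp [single_apply, hC]
    · exact fun h' => absurd (Finset.mem_powerset.2 h) h'
  · refine Finset.sum_eq_zero fun C hC => ?_
    have : C ≠ A := by
      rintro rfl
      exact h (Finset.mem_powerset.1 hC)
    simp [single_apply, this]

protected lemma mul_comm (f g : SetAlgebra ι) : f * g = g * f := by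
  refine ext_apply fun A => ?_
  rw [coeff_mul, coeff_mul]
  refine Finset.sum_nbij' (fun B => A \ B) (fun B => A \ B) (by simp) (by simp) ?_ ?_ ?_
  · intro B hB
    exact Finset.sdiff_sdiff_eq_self (Finset.mem_powerset.1 hB)
  · intro B hB
    exact Finset.sdiff_sdiff_eq_self (Finset.mem_powerset.1 hB)
  · intro B hB
    rw [Finset.sdiff_sdiff_eq_self (Finset.mem_powerset.1 hB), mul_comm]

protected lemma one_mul (f : SetAlgebra ι) : 1 * f = f := by
  refine ext_apply fun A => ?_
  change coeff (single ∅ 1 * f) A = f A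
  rw [single_mul_apply]
  simp

protected lemma mul_assoc (f g h : SetAlgebra ι) : f * g * h = f * (g * h) := by
  refine ext_apply fun A => ?_
  simp only [coeff_mul, Finset.sum_mul, Finset.mul_sum]
  rw [Finset.sum_sigma', Finset.sum_sigma']
  refine Finset.sum_nbij' (fun p => ⟨p.2, p.1 \ p.2⟩) (fun p => ⟨p.1 ∪ p.2, p.1⟩) ?_ ?_ ?_ ?_ ?_
  · rintro ⟨B, C⟩ h
    simp only [Finset.mem_sigma, Finset.mem_powerset] at h ⊢
    exact ⟨h.2.trans h.1, Finset.sdiff_subset_sdiff h.1 le_rfl⟩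
  · rintro ⟨C, D⟩ h
    simp only [Finset.mem_sigma, Finset.mem_powerset] at h ⊢
    exact ⟨Finset.union_subset h.1 (h.2.trans Finset.sdiff_subset), Finset.subset_union_left⟩
  · rintro ⟨B, C⟩ h
    simp only [Finset.mem_sigma, Finset.mem_powerset] at h ⊢
    rw [Finset.union_sdiff_of_subset h.2]
  · rintro ⟨C, D⟩ h
    simp only [Finset.mem_sigma, Finset.mem_powerset] at h ⊢
    rw [Finset.union_sdiff_cancel_left (Finset.disjoint_sdiff.mono_right h.2)]
  · rintro ⟨B, C⟩ h
    simp only [Finset.mem_sigma, Finset.mem_powerset] at h ⊢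
    have : (A \ C) \ (B \ C) = A \ B := by
      ext i
      have := @h.2 i
      simp only [Finset.mem_sdiff]
      tauto
    rw [this, mul_assoc]

protected lemma left_distrib (f g h : SetAlgebra ι) : f * (g + h) = f * g + f * h := by
  refine ext_apply fun A => ?_
  simp [coeff_mul, mul_add, Finset.sum_add_distrib]

instance : CommRing (SetAlgebra ι) :=
  { (inferInstance : AddCommGroup (SetAlgebra ι)) with
    mul := (· * ·)
    one := 1
    mul_assoc := SetAlgebra.mul_assoc
    one_mul := SetAlgebra.one_mul
    mul_one := fun f => by rw [SetAlgebra.mul_comm, SetAlgebra.one_mul]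
    left_distrib := SetAlgebra.left_distrib
    right_distrib := fun f g h => by
      rw [SetAlgebra.mul_comm, SetAlgebra.left_distrib, SetAlgebra.mul_comm h,
        SetAlgebra.mul_comm h]
    zero_mul := fun f => by refine ext_apply fun A => ?_; simp [coeff_mul]
    mul_zero := fun f => by refine ext_apply fun A => ?_; simp [coeff_mul]
    mul_comm := SetAlgebra.mul_comm }

/-- The constants, as set functions supported at the empty set. -/
def constHom (ι : Type*) [DecidableEq ι] : ℂ →+* SetAlgebra ι where
  toFun c := single ∅ c
  map_one' := rfl
  map_zero' := by refine ext_apply fun A => ?_; simp [single_apply]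
  map_add' a b := by refine ext_apply fun A => ?_; by_cases h : A = ∅ <;> simp [single_apply, h]
  map_mul' a b := by
    refine ext_apply fun A => ?_
    rw [single_mul_apply]
    by_cases h : A = ∅ <;> simp [single_apply, h]

noncomputable instance : Algebra ℝ (SetAlgebra ι) :=
  ((constHom ι).comp Complex.ofRealHom).toAlgebra

lemma algebraMap_eq (r : ℝ) : algebraMap ℝ (SetAlgebra ι) r = single ∅ (r : ℂ) := rfl

@[simp] lemma const_mul_apply (c : ℂ) (f : SetAlgebra ι) (A : Finset ι) :
    coeff (single ∅ c * f) A = c * f A := by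
  simp [single_mul_apply]

open scoped ComplexOrder

/-- The set functions with nonnegative values. -/
def nonneg (ι : Type*) [DecidableEq ι] : Subsemiring (SetAlgebra ι) where
  carrier := {f | ∀ A, 0 ≤ f A}
  mul_mem' hf hg A := Finset.sum_nonneg fun B _ => mul_nonneg (hf B) (hg _)
  one_mem' A := by
    rw [coeff_one]
    split_ifs
    · exact zero_le_one
    · exact le_rfl
  add_mem' hf hg A := add_nonneg (hf A) (hg A)
  zero_mem' _ := le_rfl

/-- The generators square to zero because convolution only joins disjoint sets. -/
lemma imaginarySources (ι : Type*) [DecidableEq ι] :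
    ImaginarySources (nonneg ι) (single ∅ Complex.I) (fun i => single {i} 1) where
  sq_I := by
    change constHom ι Complex.I * constHom ι Complex.I = -1
    rw [← map_mul, Complex.I_mul_I, map_neg, map_one]
  algebraMap_mem r hr A := by
    rw [algebraMap_eq, single_apply]
    split_ifs
    · exact Complex.zero_le_real.2 hr
    · exact le_rfl
  mem i A := by
    simp only [single_apply]
    split_ifs
    · exact zero_le_one
    · exact le_rfl
  sq_zero i := by
    refine ext_apply fun A => ?_
    rw [single_mul_apply]
    split_ifs with h
    · rw [single_apply, if_neg]
      · simp
      · intro h'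
        have : i ∈ A \ {i} := by rw [h']; simp
        simp at this
    · rfl

end SetAlgebra

/-! ### From positivity with imaginary sources to signs of real coefficients -/

section Coefficients

open scoped ComplexOrder

variable {V : Type*} [Fintype V] [DecidableEq V] {ι : Type*} [DecidableEq ι]

open SetAlgebra

lemma sourceFactor_apply (s : ι → V) (σ : SpinConfig V) (B A : Finset ι) :
    coeff (sourceFactor (fun i => single ∅ Complex.I * single {i} 1) s B σ) A =
      if A ⊆ B then Complex.I ^ A.card * ((∏ i ∈ A, spin (s i) σ : ℝ) : ℂ) else 0 := by
  induction B using Finset.induction_on generalizing A with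
  | empty =>
    by_cases h : A = ∅ <;> simp [sourceFactor, coeff_one, h]
  | insert i B hi ih =>
    have h1 : sourceFactor (fun i => single ∅ Complex.I * single {i} 1) s (insert i B) σ =
        sourceFactor (fun i => single ∅ Complex.I * single {i} 1) s B σ +
        single ∅ ((spin (s i) σ : ℝ) : ℂ) * (single ∅ Complex.I * (single {i} 1 *
          sourceFactor (fun i => single ∅ Complex.I * single {i} 1) s B σ)) := by
      rw [sourceFactor, Finset.prod_insert hi, ← sourceFactor, algebraMap_eq]
      ring
    rw [h1, coeff_add, const_mul_apply, const_mul_apply, single_mul_apply, ih, ih]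
    by_cases hA : i ∈ A
    · have h2 : ¬ A ⊆ B := fun h => hi (h hA)
      have h3 : A \ {i} ⊆ B ↔ A ⊆ insert i B := by
        rw [Finset.sdiff_singleton_eq_erase, Finset.subset_insert_iff]
      rw [if_neg h2, if_pos (Finset.singleton_subset_iff.2 hA)]
      simp only [h3]
      split_ifs
      · rw [Finset.sdiff_singleton_eq_erase, ← Finset.mul_prod_erase A _ hA,
          ← Finset.card_erase_add_one hA]
        push_cast
        ring
      · simp
    · have h2 : A ⊆ insert i B ↔ A ⊆ B := Finset.subset_insert_iff_of_notMem hA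
      rw [if_neg (fun h => hA (Finset.singleton_subset_iff.1 h))]
      simp [h2]

/-- Coefficients of correlations are moments up to a power of I, so identities in the algebra are
convolution identities between moments. -/
lemma corr_apply (K : V × V → ℝ) (s : ι → V) (f : SpinConfig V → ℝ) {A B : Finset ι}
    (h : A ⊆ B) :
    coeff (corr K (fun i => single ∅ Complex.I * single {i} 1) s B f) A = Complex.I ^ A.card *
      ((∑ σ, f σ * bondWeight K σ * ∏ i ∈ A, spin (s i) σ : ℝ) : ℂ) := by
  rw [corr, coeff_sum, Complex.ofReal_sum, Finset.mul_sum]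
  refine Finset.sum_congr rfl fun σ _ => ?_
  rw [algebraMap_eq, const_mul_apply, sourceFactor_apply, if_pos h]
  push_cast
  ring

lemma neg_I_pow_mul (n : ℕ) : (-Complex.I) ^ n * Complex.I ^ n = 1 := by
  rw [← mul_pow, neg_mul, Complex.I_mul_I, neg_neg, one_pow]

/-- Signs of the solution of the convolution equation for the magnetization. -/
lemma exists_magnetization_coeff [Fintype ι] (K : V × V → ℝ) (hK : ∀ p, 0 ≤ K p) (s : ι → V)
    (w : V) : ∃ m : Finset ι → ℝ,
      (∀ A : Finset ι, ∑ B ∈ A.powerset,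
        m B * ∑ σ, bondWeight K σ * ∏ i ∈ A \ B, spin (s i) σ =
          ∑ σ, spin w σ * bondWeight K σ * ∏ i ∈ A, spin (s i) σ) ∧
      ∀ (k : ℕ) (A : Finset ι), A.card = 2 * k + 1 → 0 ≤ (-1) ^ k * m A := by
  obtain ⟨m, hm, e⟩ := ((imaginarySources ι).positivity s Finset.univ).1 K hK w
  -- The power of -I undoes the I of each source. The moments are real, so taking real parts
  -- preserves the convolution equation.
  refine ⟨fun A => (Complex.I * (-Complex.I) ^ A.card * m A).re, fun A => ?_, fun k A hA => ?_⟩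
  · have e1 := congrArg (fun f => coeff f A) e
    beta_reduce at e1
    rw [corr_apply K s _ (Finset.subset_univ A), mul_assoc, const_mul_apply, coeff_mul] at e1
    have e2 : ∑ B ∈ A.powerset, (Complex.I * (-Complex.I) ^ B.card * m B) *
        ((∑ σ, bondWeight K σ * ∏ i ∈ A \ B, spin (s i) σ : ℝ) : ℂ) =
          ((∑ σ, spin w σ * bondWeight K σ * ∏ i ∈ A, spin (s i) σ : ℝ) : ℂ) := by
      rw [← one_mul ((∑ σ, spin w σ * bondWeight K σ * ∏ i ∈ A, spin (s i) σ : ℝ) : ℂ),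
        ← neg_I_pow_mul A.card, mul_assoc, e1, Finset.mul_sum, Finset.mul_sum]
      refine Finset.sum_congr rfl fun B hB => ?_
      rw [corr_apply K s _ (Finset.subset_univ _)]
      have hc := Finset.card_sdiff_add_card_eq_card (Finset.mem_powerset.1 hB)
      simp only [Pi.one_apply, one_mul]
      rw [← hc, pow_add]
      linear_combination (-Complex.I * (-Complex.I) ^ B.card * m B *
        ((∑ σ, bondWeight K σ * ∏ i ∈ A \ B, spin (s i) σ : ℝ) : ℂ)) *
          neg_I_pow_mul (A \ B).card
    have e3 := congrArg Complex.re e2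
    rw [Complex.re_sum, Complex.ofReal_re] at e3
    simpa only [Complex.re_mul_ofReal] using e3
  · beta_reduce
    have h1 : Complex.I * (-Complex.I) ^ A.card = ((-1) ^ k : ℝ) := by
      rw [hA, pow_succ, pow_mul]
      push_cast
      simp only [even_two, Even.neg_pow, Complex.I_sq]
      linear_combination (-(-1 : ℂ) ^ k) * Complex.I_mul_I
    have h2 : 0 ≤ (m A).re := (Complex.le_def.1 (hm A)).1
    rw [h1, Complex.re_ofReal_mul, ← mul_assoc, ← mul_pow]
    simpa using h2

/-- Signs of the solution of the convolution equation for a pair correlation. -/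
lemma exists_pair_coeff [Fintype ι] (K : V × V → ℝ) (hK : ∀ p, 0 ≤ K p) (s : ι → V)
    (u v : V) : ∃ m : Finset ι → ℝ,
      (∀ A : Finset ι, ∑ B ∈ A.powerset,
        m B * ∑ σ, bondWeight K σ * ∏ i ∈ A \ B, spin (s i) σ =
          ∑ σ, spin u σ * spin v σ * bondWeight K σ * ∏ i ∈ A, spin (s i) σ) ∧
      ∀ (k : ℕ) (A : Finset ι), A.card = 2 * (k + 1) → 0 ≤ (-1) ^ k * m A := by
  obtain ⟨r, -, n, hn, -, e⟩ := ((imaginarySources ι).positivity s Finset.univ).2 K hK u v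
  set m : SetAlgebra ι := algebraMap ℝ _ r - n with hm
  refine ⟨fun A => ((-Complex.I) ^ A.card * m A).re, fun A => ?_, fun k A hA => ?_⟩
  · have e1 := congrArg (fun f => coeff f A) e
    beta_reduce at e1
    rw [corr_apply K s _ (Finset.subset_univ A), coeff_mul] at e1
    have e2 : ∑ B ∈ A.powerset, ((-Complex.I) ^ B.card * m B) *
        ((∑ σ, bondWeight K σ * ∏ i ∈ A \ B, spin (s i) σ : ℝ) : ℂ) =
          ((∑ σ, spin u σ * spin v σ * bondWeight K σ * ∏ i ∈ A, spin (s i) σ : ℝ) : ℂ) := by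
      rw [← one_mul
        ((∑ σ, spin u σ * spin v σ * bondWeight K σ * ∏ i ∈ A, spin (s i) σ : ℝ) : ℂ),
        ← neg_I_pow_mul A.card, mul_assoc, e1, Finset.mul_sum]
      refine Finset.sum_congr rfl fun B hB => ?_
      rw [corr_apply K s _ (Finset.subset_univ _)]
      have hc := Finset.card_sdiff_add_card_eq_card (Finset.mem_powerset.1 hB)
      simp only [Pi.one_apply, one_mul]
      rw [← hc, pow_add]
      linear_combination (-(-Complex.I) ^ B.card * m B *
        ((∑ σ, bondWeight K σ * ∏ i ∈ A \ B, spin (s i) σ : ℝ) : ℂ)) *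
          neg_I_pow_mul (A \ B).card
    have e3 := congrArg Complex.re e2
    rw [Complex.re_sum, Complex.ofReal_re] at e3
    simpa only [Complex.re_mul_ofReal] using e3
  · beta_reduce
    have h0 : A ≠ ∅ := by
      rintro rfl
      simp at hA
    -- This minus sign cancels that of -n; the constant r is supported at ∅ and does not enter.
    have h1 : (-Complex.I) ^ A.card = ((-(-1) ^ k : ℝ) : ℂ) := by
      rw [hA, pow_mul, pow_succ]
      push_cast
      simp
    have h2 : 0 ≤ (n A).re := (Complex.le_def.1 (hn A)).1
    have h3 : m A = -n A := by simp [hm, algebraMap_eq, single_apply, h0]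
    rw [h1, h3, Complex.re_ofReal_mul, ← mul_assoc, mul_neg, ← mul_pow]
    simpa using h2

end Coefficients

/-! ### Ursell functions of set functions -/

section Ursell

variable {α : Type*} [DecidableEq α]

/-- The partitions of `A` into nonempty blocks, as sets of blocks. -/
def setPartitions (A : Finset α) : Finset (Finset (Finset α)) :=
  A.powerset.powerset.filter fun Q => ∅ ∉ Q ∧ Q.sup id = A ∧ ∀ B ∈ Q, ∀ C ∈ Q, B ≠ C → Disjoint B C

lemma mem_setPartitions {A : Finset α} {Q : Finset (Finset α)} :
    Q ∈ setPartitions A ↔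
      ∅ ∉ Q ∧ Q.sup id = A ∧ ∀ B ∈ Q, ∀ C ∈ Q, B ≠ C → Disjoint B C := by
  rw [setPartitions, Finset.mem_filter, and_iff_right_iff_imp]
  rintro ⟨-, rfl, -⟩
  exact Finset.mem_powerset.2 fun B hB => Finset.mem_powerset.2 (Finset.le_sup (f := id) hB)

/-- The coefficient of a partition into `q` blocks in the Ursell function. -/
def partitionCoeff (q : ℕ) : ℝ := (-1) ^ (q - 1) * ((q - 1)! : ℝ)

/-- The Ursell function of the set function of moments `e`. -/
def setUrsell (e : Finset α → ℝ) (A : Finset α) : ℝ :=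
  ∑ Q ∈ setPartitions A, partitionCoeff Q.card * ∏ B ∈ Q, e B

lemma ursell_eq_setUrsell {Ω : Type*} [Fintype Ω] (p : Ω → ℝ) {n : ℕ} (X : Fin n → Ω → ℝ) :
    ursell p X = setUrsell (fun B => expect p (fun ω => ∏ i ∈ B, X i ω)) Finset.univ := by
  refine Finset.sum_bij (fun P _ => P.parts) ?_ ?_ ?_ (fun _ _ => rfl)
  · intro P _
    exact mem_setPartitions.2 ⟨P.bot_notMem, P.sup_parts,
      fun B hB C hC h => P.disjoint hB hC h⟩
  · intro P _ P' _ h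
    exact Finpartition.ext h
  · intro Q hQ
    obtain ⟨h1, h2, h3⟩ := mem_setPartitions.1 hQ
    exact ⟨⟨Q, Finset.supIndep_iff_pairwiseDisjoint.2 (fun B hB C hC h => h3 B hB C hC h), h2, h1⟩,
      Finset.mem_univ _, rfl⟩

/-- In the recursion for Ursell functions a partition into q blocks arises once as itself and q - 1
times by splitting off a block that avoids the marked point. -/
lemma partitionCoeff_add {q : ℕ} (hq : 2 ≤ q) :
    partitionCoeff q + ((q - 1 : ℕ) : ℝ) * partitionCoeff (q - 1) = 0 := by
  obtain ⟨r, rfl⟩ := Nat.exists_eq_add_of_le' hq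
  simp only [partitionCoeff, show r + 2 - 1 = r + 1 from rfl, show r + 1 - 1 = r from rfl,
    Nat.factorial_succ]
  push_cast
  ring

lemma card_filter_notMem_block {A : Finset α} {Q : Finset (Finset α)} (hQ : Q ∈ setPartitions A)
    {j : α} (hj : j ∈ A) : (Q.filter fun D => j ∉ D).card = Q.card - 1 := by
  obtain ⟨-, h2, h3⟩ := mem_setPartitions.1 hQ
  rw [← h2, Finset.mem_sup] at hj
  obtain ⟨D, hD, hjD⟩ := hj
  have : (Q.filter fun D => j ∉ D) = Q.erase D := by
    ext C
    simp only [Finset.mem_filter, Finset.mem_erase]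
    constructor
    · rintro ⟨hC, hjC⟩
      exact ⟨fun h => hjC (h ▸ hjD), hC⟩
    · rintro ⟨hne, hC⟩
      exact ⟨hC, Finset.disjoint_left.1 (h3 D hD C hC (Ne.symm hne)) hjD⟩
  rw [this, Finset.card_erase_of_mem hD]

lemma erase_mem_setPartitions {A D : Finset α} {Q : Finset (Finset α)} (hQ : Q ∈ setPartitions A)
    (hD : D ∈ Q) : Q.erase D ∈ setPartitions (A \ D) := by
  obtain ⟨h1, h2, h3⟩ := mem_setPartitions.1 hQ
  refine mem_setPartitions.2 ⟨fun h => h1 (Finset.mem_of_mem_erase h), ?_,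
    fun B hB C hC => h3 B (Finset.mem_of_mem_erase hB) C (Finset.mem_of_mem_erase hC)⟩
  ext i
  rw [← h2, Finset.mem_sdiff, Finset.mem_sup, Finset.mem_sup]
  constructor
  · rintro ⟨B, hB, hi⟩
    rw [Finset.mem_erase] at hB
    exact ⟨⟨B, hB.2, hi⟩, Finset.disjoint_left.1 (h3 B hB.2 D hD hB.1) hi⟩
  · rintro ⟨⟨B, hB, hi⟩, hiD⟩
    exact ⟨B, Finset.mem_erase.2 ⟨fun h => hiD (h ▸ hi), hB⟩, hi⟩

lemma insert_mem_setPartitions {A B : Finset α} {P : Finset (Finset α)} (hB : B ⊆ A) (hne : B ≠ A)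
    (hP : P ∈ setPartitions B) : insert (A \ B) P ∈ setPartitions A ∧ A \ B ∉ P := by
  obtain ⟨h1, h2, h3⟩ := mem_setPartitions.1 hP
  have hne' : (A \ B).Nonempty := Finset.sdiff_nonempty.2 fun h => hne (hB.antisymm h)
  have hd : ∀ C ∈ P, Disjoint (A \ B) C := fun C hC =>
    Finset.sdiff_disjoint.mono_right (by rw [← h2]; exact Finset.le_sup (f := id) hC)
  refine ⟨mem_setPartitions.2 ⟨?_, ?_, ?_⟩, fun h => ?_⟩
  · rw [Finset.mem_insert, not_or]
    exact ⟨hne'.ne_empty.symm, h1⟩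
  · rw [Finset.sup_insert, h2]
    exact Finset.sdiff_union_of_subset hB
  · intro C hC C' hC' hCC
    rw [Finset.mem_insert] at hC hC'
    rcases hC with rfl | hC <;> rcases hC' with rfl | hC'
    · exact absurd rfl hCC
    · exact hd _ hC'
    · exact (hd _ hC).symm
    · exact h3 C hC C' hC' hCC
  · exact hne'.ne_empty (disjoint_self.1 (hd _ h))

/-- The recursion determining Ursell functions. -/
lemma sum_setUrsell_mul (e : Finset α → ℝ) (he : e ∅ = 1) {A : Finset α} {j : α} (hj : j ∈ A) :
    ∑ B ∈ A.powerset with j ∈ B, setUrsell e B * e (A \ B) = e A := by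
  have hA : A ∈ A.powerset.filter (fun B => j ∈ B) := by simp [hj]
  rw [← Finset.add_sum_erase _ _ hA, Finset.sdiff_self, he, mul_one]
  -- A partition of B ∋ j with the block D = A \ B adjoined is a partition of A with a chosen block
  -- avoiding j.
  have h1 : ∑ B ∈ (A.powerset.filter (fun B => j ∈ B)).erase A, setUrsell e B * e (A \ B) =
      ∑ Q ∈ setPartitions A, ∑ D ∈ Q with j ∉ D, partitionCoeff (Q.card - 1) * ∏ B ∈ Q, e B := by
    simp only [setUrsell, Finset.sum_mul]
    rw [Finset.sum_sigma', Finset.sum_sigma']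
    refine Finset.sum_bij' (fun p _ => ⟨insert (A \ p.1) p.2, A \ p.1⟩)
      (fun p _ => ⟨A \ p.2, p.1.erase p.2⟩) ?_ ?_ ?_ ?_ ?_
    · rintro ⟨B, P⟩ h
      simp only [Finset.mem_sigma, Finset.mem_erase, Finset.mem_filter, Finset.mem_powerset] at h ⊢
      obtain ⟨⟨hne, hB, hjB⟩, hP⟩ := h
      exact ⟨(insert_mem_setPartitions hB hne hP).1, Finset.mem_insert_self _ _, by simp [hjB]⟩
    · rintro ⟨Q, D⟩ h
      simp only [Finset.mem_sigma, Finset.mem_erase, Finset.mem_filter, Finset.mem_powerset] at h ⊢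
      obtain ⟨hQ, hD, hjD⟩ := h
      obtain ⟨h1, h2, -⟩ := mem_setPartitions.1 hQ
      have hDA : D ⊆ A := by rw [← h2]; exact Finset.le_sup (f := id) hD
      refine ⟨⟨fun h => ?_, Finset.sdiff_subset, Finset.mem_sdiff.2 ⟨hj, hjD⟩⟩,
        erase_mem_setPartitions hQ hD⟩
      have h3 : D = ∅ := by rw [← Finset.sdiff_sdiff_eq_self hDA, h, Finset.sdiff_self]
      exact h1 (h3 ▸ hD)
    · rintro ⟨B, P⟩ h
      simp only [Finset.mem_sigma, Finset.mem_erase, Finset.mem_filter, Finset.mem_powerset] at h ⊢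
      obtain ⟨⟨hne, hB, hjB⟩, hP⟩ := h
      rw [Finset.sdiff_sdiff_eq_self hB, Finset.erase_insert (insert_mem_setPartitions hB hne hP).2]
    · rintro ⟨Q, D⟩ h
      simp only [Finset.mem_sigma, Finset.mem_filter] at h
      obtain ⟨hQ, hD, hjD⟩ := h
      obtain ⟨-, h2, -⟩ := mem_setPartitions.1 hQ
      have hDA : D ⊆ A := by rw [← h2]; exact Finset.le_sup (f := id) hD
      rw [Finset.sdiff_sdiff_eq_self hDA, Finset.insert_erase hD]
    · rintro ⟨B, P⟩ h
      simp only [Finset.mem_sigma, Finset.mem_erase, Finset.mem_filter, Finset.mem_powerset] at h ⊢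
      obtain ⟨⟨hne, hB, hjB⟩, hP⟩ := h
      have h2 := (insert_mem_setPartitions hB hne hP).2
      rw [Finset.card_insert_of_notMem h2, Finset.prod_insert h2, Nat.add_sub_cancel]
      ring
  rw [h1, setUrsell, ← Finset.sum_add_distrib]
  have h2 : ∀ Q ∈ setPartitions A, partitionCoeff Q.card * ∏ B ∈ Q, e B +
      ∑ D ∈ Q with j ∉ D, partitionCoeff (Q.card - 1) * ∏ B ∈ Q, e B =
      if Q = {A} then e A else 0 := by
    intro Q hQ
    rw [Finset.sum_const, card_filter_notMem_block hQ hj, nsmul_eq_mul, ← mul_assoc, ← add_mul]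
    obtain ⟨-, h2, -⟩ := mem_setPartitions.1 hQ
    split_ifs with h
    · subst h
      simp [partitionCoeff]
    · have hc : 2 ≤ Q.card := by
        by_contra hc
        have : Q.card = 0 ∨ Q.card = 1 := by omega
        rcases this with h0 | h0
        · rw [Finset.card_eq_zero] at h0
          subst h0
          rw [← h2] at hj
          simp at hj
        · obtain ⟨D, rfl⟩ := Finset.card_eq_one.1 h0
          rw [Finset.sup_singleton, id] at h2
          exact h (by rw [h2])
      rw [partitionCoeff_add hc, zero_mul]
  rw [Finset.sum_congr rfl h2, Finset.sum_ite_eq', if_pos]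
  refine mem_setPartitions.2 ⟨?_, by simp, ?_⟩
  · rw [Finset.mem_singleton]
    rintro rfl
    simp at hj
  · intro B hB C hC h
    rw [Finset.mem_singleton] at hB hC
    exact absurd (hB.trans hC.symm) h

/-- The convolution equation that characterizes Ursell functions of sets containing `i`. -/
lemma setUrsell_insert_eq (e : Finset α → ℝ) (he : e ∅ = 1) (i : α) (m : Finset α → ℝ)
    (hm : ∀ A : Finset α, i ∉ A → ∑ B ∈ A.powerset, m B * e (A \ B) = e (insert i A))
    {A : Finset α} (hA : i ∉ A) : setUrsell e (insert i A) = m A := by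
  induction A using Finset.strongInduction with
  | _ A ih =>
    -- With j = i, the Ursell functions solve the same triangular system as m, with diagonal entry e
    -- ∅ = 1.
    have h1 := sum_setUrsell_mul e he (Finset.mem_insert_self i A)
    have h2 : ∑ B ∈ (insert i A).powerset with i ∈ B, setUrsell e B * e (insert i A \ B) =
        ∑ B ∈ A.powerset, setUrsell e (insert i B) * e (A \ B) := by
      refine Finset.sum_bij' (fun B _ => B.erase i) (fun B _ => insert i B) ?_ ?_ ?_ ?_ ?_
      · intro B hB
        simp only [Finset.mem_filter, Finset.mem_powerset] at hB ⊢
        exact Finset.subset_insert_iff.1 hB.1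
      · intro B hB
        simp only [Finset.mem_filter, Finset.mem_powerset] at hB ⊢
        exact ⟨Finset.insert_subset_insert i hB, Finset.mem_insert_self i B⟩
      · intro B hB
        exact Finset.insert_erase (Finset.mem_filter.1 hB).2
      · intro B hB
        exact Finset.erase_insert fun h => hA (Finset.mem_powerset.1 hB h)
      · intro B hB
        have hi := (Finset.mem_filter.1 hB).2
        have h3 : insert i A \ B = A \ B.erase i := by
          ext a
          simp only [Finset.mem_sdiff, Finset.mem_insert, Finset.mem_erase]
          by_cases ha : a = i
          · subst ha; simp [hi, hA]
          · simp [ha]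
        rw [Finset.insert_erase hi, h3]
    have hAA : A ∈ A.powerset := Finset.mem_powerset_self A
    have h3 := hm A hA
    rw [h2, ← h3, ← Finset.add_sum_erase _ _ hAA, ← Finset.add_sum_erase _ _ hAA,
      Finset.sdiff_self, he, mul_one, mul_one] at h1
    have h4 : ∑ B ∈ A.powerset.erase A, setUrsell e (insert i B) * e (A \ B) =
        ∑ B ∈ A.powerset.erase A, m B * e (A \ B) := by
      refine Finset.sum_congr rfl fun B hB => ?_
      rw [Finset.mem_erase, Finset.mem_powerset] at hB
      rw [ih B (hB.2.ssubset_of_ne hB.1) fun h => hA (hB.2 h)]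
    rw [h4] at h1
    exact add_right_cancel h1

/-- The derivative of Ursell functions along a change of measure. -/
lemma hasDerivAt_setUrsell (e : ℝ → Finset α → ℝ) (he : ∀ t, e t ∅ = 1) (t : ℝ)
    (d r : Finset α → ℝ) (hd : ∀ A, HasDerivAt (fun t => e t A) (d A - e t A * d ∅) t)
    (hr : ∀ A : Finset α, ∑ B ∈ A.powerset, r B * e t (A \ B) = d A)
    {A : Finset α} (hA : A.Nonempty) : HasDerivAt (fun t => setUrsell (e t) A) (r A) t := by
  induction A using Finset.strongInduction with
  | _ A ih =>
    obtain ⟨j, hj⟩ := hA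
    set S := A.powerset.filter fun B => j ∈ B with hS
    have hAS : A ∈ S := by simp [hS, hj]
    -- Solving the recursion for its top term leaves only smaller sets containing j, so it can be
    -- differentiated inductively.
    have hrec : ∀ t, setUrsell (e t) A =
        e t A - ∑ B ∈ S.erase A, setUrsell (e t) B * e t (A \ B) := fun t => by
      have := sum_setUrsell_mul (e t) (he t) hj
      rw [← Finset.add_sum_erase _ _ hAS, Finset.sdiff_self, he, mul_one] at this
      linarith
    -- This is the differentiated recursion with r in place of the derivative of the Ursell
    -- function. Expanding d as the convolution of r and e, and resumming over B ∋ j, turns the u·d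
    -- terms into the missing terms C ∌ j of that convolution at A.
    have key : ∑ B ∈ S, (r B * e t (A \ B) +
        setUrsell (e t) B * (d (A \ B) - e t (A \ B) * d ∅)) = d A - e t A * d ∅ := by
      have h1 : ∑ B ∈ S, setUrsell (e t) B * d (A \ B) =
          ∑ C ∈ A.powerset with j ∉ C, r C * e t (A \ C) := by
        have h2 : ∑ B ∈ S, setUrsell (e t) B * d (A \ B) =
            ∑ B ∈ S, ∑ C ∈ (A \ B).powerset,
              setUrsell (e t) B * (r C * e t ((A \ B) \ C)) := by
          refine Finset.sum_congr rfl fun B _ => ?_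
          rw [← hr, Finset.mul_sum]
        have h3 : ∑ C ∈ A.powerset with j ∉ C, r C * e t (A \ C) =
            ∑ C ∈ A.powerset with j ∉ C, ∑ B ∈ (A \ C).powerset with j ∈ B,
              setUrsell (e t) B * (r C * e t ((A \ B) \ C)) := by
          refine Finset.sum_congr rfl fun C hC => ?_
          rw [← sum_setUrsell_mul (e t) (he t) (A := A \ C) (j := j), Finset.mul_sum]
          · refine Finset.sum_congr rfl fun B _ => ?_
            rw [sdiff_right_comm]
            ring
          · exact Finset.mem_sdiff.2 ⟨hj, (Finset.mem_filter.1 hC).2⟩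
        rw [h2, h3]
        refine Finset.sum_comm' fun B C => ?_
        simp only [hS, Finset.mem_filter, Finset.mem_powerset, Finset.subset_sdiff]
        constructor
        · rintro ⟨⟨hB, hjB⟩, hC, hCB⟩
          exact ⟨⟨⟨hB, hCB.symm⟩, hjB⟩, hC, Finset.disjoint_right.1 hCB hjB⟩
        · rintro ⟨⟨⟨hB, hBC⟩, hjB⟩, hC, -⟩
          exact ⟨⟨hB, hjB⟩, hC, hBC.symm⟩
      have h4 := Finset.sum_filter_add_sum_filter_not A.powerset (fun B => j ∈ B)
        (fun B => r B * e t (A \ B))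
      have h5 := sum_setUrsell_mul (e t) (he t) hj
      have h6 : ∑ B ∈ S, setUrsell (e t) B * (e t (A \ B) * d ∅) = e t A * d ∅ := by
        rw [← h5, Finset.sum_mul]
        exact Finset.sum_congr rfl fun B _ => by ring
      rw [Finset.sum_add_distrib]
      simp only [mul_sub, Finset.sum_sub_distrib]
      rw [h1, h6, ← hr A, ← h4]
      ring
    rw [← Finset.add_sum_erase _ _ hAS, Finset.sdiff_self, he, mul_one, one_mul, sub_self,
      mul_zero, add_zero] at key
    simp only [hrec]
    have hval : r A = (d A - e t A * d ∅) - ∑ B ∈ S.erase A, (r B * e t (A \ B) +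
        setUrsell (e t) B * (d (A \ B) - e t (A \ B) * d ∅)) := by linarith
    rw [hval]
    refine (hd A).sub (HasDerivAt.fun_sum fun B hB => ?_)
    simp only [hS, Finset.mem_erase, Finset.mem_filter, Finset.mem_powerset] at hB
    exact (ih B (hB.2.1.ssubset_of_ne hB.1) ⟨j, hB.2.2⟩).mul (hd _)

end Ursell

/-! ### Application to the Ising model -/

section IsingUrsell

variable {V : Type*} [Fintype V] [DecidableEq V] (G : SimpleGraph V) [DecidableRel G.Adj]

/-- The couplings of the Ising model as couplings of ordered pairs. -/
noncomputable def edgeCoupling (J : G.edgeSet → ℝ) (p : V × V) : ℝ :=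
  ∑ e : G.edgeSet, if Quot.out (e : Sym2 V) = p then J e else 0

lemma edgeCoupling_nonneg {J : G.edgeSet → ℝ} (hJ : ∀ e, 0 ≤ J e) (p : V × V) :
    0 ≤ edgeCoupling G J p :=
  Finset.sum_nonneg fun e _ => by
    split_ifs
    · exact hJ e
    · exact le_rfl

lemma pairSpin_eq_out (σ : SpinConfig V) (z : Sym2 V) :
    pairSpin σ z = spin (Quot.out z).1 σ * spin (Quot.out z).2 σ := by
  conv_lhs => rw [← Quot.out_eq z]
  rfl

lemma isingWeight_eq_bondWeight (J : G.edgeSet → ℝ) (σ : SpinConfig V) :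
    isingWeight G J σ = bondWeight (edgeCoupling G J) σ := by
  rw [isingWeight, bondWeight]
  congr 1
  simp only [edgeCoupling, Finset.sum_mul]
  rw [Finset.sum_comm]
  refine Finset.sum_congr rfl fun e _ => ?_
  -- Each edge sits on one chosen orientation, so it is counted once.
  rw [Finset.sum_eq_single (Quot.out (e : Sym2 V)), if_pos rfl, pairSpin_eq_out]
  · intro p _ hp
    rw [if_neg (Ne.symm hp), zero_mul]
  · simp

lemma isingZ_pos (J : G.edgeSet → ℝ) : 0 < isingZ G J :=
  Finset.sum_pos (fun _ _ => Real.exp_pos _) Finset.univ_nonempty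

lemma expect_isingProb (J : G.edgeSet → ℝ) (f : SpinConfig V → ℝ) :
    expect (isingProb G J) f = (∑ σ, f σ * isingWeight G J σ) / isingZ G J := by
  rw [expect, Finset.sum_div]
  refine Finset.sum_congr rfl fun σ _ => ?_
  rw [isingProb]
  ring

lemma expect_isingProb_one (J : G.edgeSet → ℝ) : expect (isingProb G J) (fun _ => 1) = 1 := by
  rw [expect_isingProb]
  simp only [one_mul]
  exact div_self (isingZ_pos G J).ne'

lemma hasDerivAt_isingWeight (J : G.edgeSet → ℝ) (e : G.edgeSet) (t : ℝ) (σ : SpinConfig V) :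
    HasDerivAt (fun t => isingWeight G (Function.update J e t) σ)
      (pairSpin σ e * isingWeight G (Function.update J e t) σ) t := by
  have h : HasDerivAt (fun t => ∑ e' : G.edgeSet, Function.update J e t e' * pairSpin σ e')
      (pairSpin σ e) t := by
    have h1 : ∀ t, ∑ e' : G.edgeSet, Function.update J e t e' * pairSpin σ e' =
        t * pairSpin σ e + ∑ e' ∈ Finset.univ.erase e, J e' * pairSpin σ e' := fun t => by
      rw [← Finset.add_sum_erase _ _ (Finset.mem_univ e), Function.update_self]
      congr 1
      exact Finset.sum_congr rfl fun e' he' => by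
        rw [Function.update_of_ne (Finset.ne_of_mem_erase he')]
    simp only [h1]
    simpa using ((hasDerivAt_id t).mul_const (pairSpin σ e)).add_const
      (∑ e' ∈ Finset.univ.erase e, J e' * pairSpin σ e')
  rw [mul_comm]
  exact h.exp

lemma hasDerivAt_expect_isingProb (J : G.edgeSet → ℝ) (e : G.edgeSet) (t : ℝ)
    (f : SpinConfig V → ℝ) :
    HasDerivAt (fun t => expect (isingProb G (Function.update J e t)) f)
      (expect (isingProb G (Function.update J e t)) (fun σ => pairSpin σ e * f σ) -
        expect (isingProb G (Function.update J e t)) f *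
          expect (isingProb G (Function.update J e t)) (fun σ => pairSpin σ e)) t := by
  have hN : HasDerivAt (fun t => ∑ σ, f σ * isingWeight G (Function.update J e t) σ)
      (∑ σ, f σ * (pairSpin σ e * isingWeight G (Function.update J e t) σ)) t :=
    HasDerivAt.fun_sum fun σ _ => (hasDerivAt_isingWeight G J e t σ).const_mul (f σ)
  have hZ : HasDerivAt (fun t => isingZ G (Function.update J e t))
      (∑ σ, pairSpin σ e * isingWeight G (Function.update J e t) σ) t :=
    HasDerivAt.fun_sum fun σ _ => hasDerivAt_isingWeight G J e t σ
  have hpos := (isingZ_pos G (Function.update J e t)).ne'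
  have h : ∀ σ, pairSpin σ e * f σ * isingWeight G (Function.update J e t) σ =
      f σ * (pairSpin σ e * isingWeight G (Function.update J e t) σ) := fun σ => by ring
  simp only [expect_isingProb, h]
  refine (hN.div hZ hpos).congr_deriv ?_
  field_simp

/-- The moments of the spins at the positions `j`. -/
noncomputable def isingMoment {ι : Type*} (j : ι → V) (J : G.edgeSet → ℝ) (B : Finset ι) : ℝ :=
  expect (isingProb G J) (fun σ => ∏ i ∈ B, spin (j i) σ)

lemma isingMoment_empty {ι : Type*} (j : ι → V) (J : G.edgeSet → ℝ) :
    isingMoment G j J ∅ = 1 := by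
  simpa [isingMoment] using expect_isingProb_one G J

lemma isingMoment_eq {ι : Type*} (j : ι → V) (J : G.edgeSet → ℝ) (B : Finset ι) :
    isingMoment G j J B =
      (∑ σ, bondWeight (edgeCoupling G J) σ * ∏ i ∈ B, spin (j i) σ) / isingZ G J := by
  simp only [isingMoment, expect_isingProb, isingWeight_eq_bondWeight, mul_comm]

lemma isingUrsell_eq {n : ℕ} (j : Fin n → V) (J : G.edgeSet → ℝ) :
    isingUrsell G j J = setUrsell (isingMoment G j J) Finset.univ :=
  ursell_eq_setUrsell _ _

/-- Shlosman's inequality. -/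
lemma isingUrsell_sign {J : G.edgeSet → ℝ} (hJ : ∀ e, 0 ≤ J e) {k : ℕ} (hk : 1 ≤ k)
    (j : Fin (2 * k) → V) : 0 ≤ (-1 : ℝ) ^ (k - 1) * isingUrsell G j J := by
  -- One index serves as the observed spin; the other 2k - 1 = 2(k - 1) + 1 are the sources.
  let i : Fin (2 * k) := ⟨0, by omega⟩
  obtain ⟨m, hm, hs⟩ := exists_magnetization_coeff (edgeCoupling G J) (edgeCoupling_nonneg G hJ)
    j (j i)
  have h : ∀ A : Finset (Fin (2 * k)), i ∉ A →
      ∑ B ∈ A.powerset, m B * isingMoment G j J (A \ B) = isingMoment G j J (insert i A) := by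
    intro A hA
    simp only [isingMoment_eq, ← mul_div_assoc]
    rw [← Finset.sum_div, hm]
    congr 1
    refine Finset.sum_congr rfl fun σ _ => ?_
    rw [Finset.prod_insert hA]
    ring
  have hi : i ∉ Finset.univ.erase i := Finset.notMem_erase i _
  rw [isingUrsell_eq, ← Finset.insert_erase (Finset.mem_univ i),
    setUrsell_insert_eq _ (isingMoment_empty G j J) i m h hi]
  refine hs (k - 1) _ ?_
  rw [Finset.card_erase_of_mem (Finset.mem_univ i), Finset.card_univ, Fintype.card_fin]
  omega

/-- The derivative of an Ursell function in a coupling has the sign of the Ursell function. -/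
lemma exists_hasDerivAt_isingUrsell {J : G.edgeSet → ℝ} (hJ : ∀ e, 0 ≤ J e) {k : ℕ} (hk : 1 ≤ k)
    (j : Fin (2 * k) → V) (e : G.edgeSet) :
    ∃ D, 0 ≤ (-1 : ℝ) ^ (k - 1) * D ∧
      HasDerivAt (fun t => isingUrsell G j (Function.update J e t)) D (J e) := by
  obtain ⟨r, hr, hs⟩ := exists_pair_coeff (edgeCoupling G J) (edgeCoupling_nonneg G hJ)
    j (Quot.out (e : Sym2 V)).1 (Quot.out (e : Sym2 V)).2
  -- The derivative is the coefficient of the pair correlation at the full set, of size 2((k - 1) +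
  -- 1).
  refine ⟨r Finset.univ, hs (k - 1) _ ?_, ?_⟩
  · rw [Finset.card_univ, Fintype.card_fin]
    omega
  · simp only [isingUrsell_eq]
    refine hasDerivAt_setUrsell (fun t => isingMoment G j (Function.update J e t))
      (fun t => isingMoment_empty G j _) (J e)
      (fun A => expect (isingProb G J) (fun σ => pairSpin σ e * ∏ i ∈ A, spin (j i) σ)) r
      (fun A => ?_) (fun A => ?_) ⟨⟨0, by omega⟩, Finset.mem_univ _⟩
    · have := hasDerivAt_expect_isingProb G J e (J e) (fun σ => ∏ i ∈ A, spin (j i) σ)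
      rw [Function.update_eq_self] at this
      simpa [isingMoment, Function.update_eq_self] using this
    · simp only [Function.update_eq_self, isingMoment_eq, expect_isingProb, ← mul_div_assoc,
        isingWeight_eq_bondWeight]
      rw [← Finset.sum_div, hr]
      congr 1
      refine Finset.sum_congr rfl fun σ _ => ?_
      rw [pairSpin_eq_out]
      ring

/-! ### Monotonicity in the couplings -/

lemma isingUrsell_update_mono {J : G.edgeSet → ℝ} (hJ : ∀ e, 0 ≤ J e) {k : ℕ} (hk : 1 ≤ k)
    (j : Fin (2 * k) → V) (e : G.edgeSet) {t : ℝ} (ht : J e ≤ t) :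
    (-1 : ℝ) ^ (k - 1) * isingUrsell G j J ≤
      (-1 : ℝ) ^ (k - 1) * isingUrsell G j (Function.update J e t) := by
  -- All couplings stay nonnegative along the segment, so the sign of the derivative holds at each
  -- of its points.
  have key : ∀ s ∈ Set.Icc (J e) t, ∃ D, 0 ≤ D ∧ HasDerivAt
      (fun t => (-1 : ℝ) ^ (k - 1) * isingUrsell G j (Function.update J e t)) D s := by
    intro s hs
    have hJs : ∀ e', 0 ≤ Function.update J e s e' := fun e' => by
      rcases eq_or_ne e' e with rfl | h
      · simpa using (hJ e').trans hs.1
      · rw [Function.update_of_ne h]; exact hJ e'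
    obtain ⟨D, hD, hd⟩ := exists_hasDerivAt_isingUrsell G hJs hk j e
    simp only [Function.update_idem, Function.update_self] at hd
    exact ⟨_, hD, hd.const_mul _⟩
  have hmono : MonotoneOn
      (fun t => (-1 : ℝ) ^ (k - 1) * isingUrsell G j (Function.update J e t))
      (Set.Icc (J e) t) := by
    refine monotoneOn_of_deriv_nonneg (convex_Icc _ _) (fun s hs => ?_) (fun s hs => ?_)
      (fun s hs => ?_)
    · obtain ⟨D, -, hd⟩ := key s hs
      exact hd.continuousAt.continuousWithinAt
    · obtain ⟨D, -, hd⟩ := key s (interior_subset hs)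
      exact hd.differentiableAt.differentiableWithinAt
    · obtain ⟨D, hD, hd⟩ := key s (interior_subset hs)
      rw [hd.deriv]
      exact hD
  simpa using hmono (Set.left_mem_Icc.2 ht) (Set.right_mem_Icc.2 ht) ht

lemma isingUrsell_mono {J J' : G.edgeSet → ℝ} (hJ : ∀ e, 0 ≤ J e) (hJJ' : ∀ e, J e ≤ J' e)
    {k : ℕ} (hk : 1 ≤ k) (j : Fin (2 * k) → V) :
    (-1 : ℝ) ^ (k - 1) * isingUrsell G j J ≤ (-1 : ℝ) ^ (k - 1) * isingUrsell G j J' := by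
  classical
  have key : ∀ T : Finset G.edgeSet, (-1 : ℝ) ^ (k - 1) * isingUrsell G j J ≤
      (-1 : ℝ) ^ (k - 1) * isingUrsell G j (fun e => if e ∈ T then J' e else J e) := by
    intro T
    induction T using Finset.induction_on with
    | empty => simp
    | insert e T he ih =>
      refine ih.trans ?_
      have h1 : (fun e' => if e' ∈ insert e T then J' e' else J e') =
          Function.update (fun e' => if e' ∈ T then J' e' else J e') e (J' e) := by
        funext e'
        rcases eq_or_ne e' e with rfl | h
        · simp
        · simp [h]
      rw [h1]
      refine isingUrsell_update_mono G (fun e' => ?_) hk j e (by simpa [he] using hJJ' e)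
      split_ifs
      · exact (hJ e').trans (hJJ' e')
      · exact hJ e'
  simpa using key Finset.univ

end IsingUrsell

theorem theorem1 {V : Type*} [Fintype V] [DecidableEq V] (G : SimpleGraph V) [DecidableRel G.Adj]
    (J : G.edgeSet → ℝ) (hJ : ∀ e, 0 ≤ J e) (k : ℕ) (hk : 1 ≤ k) (j : Fin (2 * k) → V) :
    (∀ e₀ : G.edgeSet,
      DifferentiableAt ℝ (fun t : ℝ => isingUrsell G j (Function.update J e₀ t)) (J e₀) ∧
      0 ≤ (-1 : ℝ) ^ (k - 1) *
        deriv (fun t : ℝ => isingUrsell G j (Function.update J e₀ t)) (J e₀)) ∧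
    (∀ J' : G.edgeSet → ℝ, (∀ e, J e ≤ J' e) → |isingUrsell G j J| ≤ |isingUrsell G j J'|) ∧
    0 ≤ (-1 : ℝ) ^ (k - 1) * isingUrsell G j J := by
  refine ⟨fun e₀ => ?_, fun J' hJJ' => ?_, isingUrsell_sign G hJ hk j⟩
  · obtain ⟨D, hD, hd⟩ := exists_hasDerivAt_isingUrsell G hJ hk j e₀
    exact ⟨hd.differentiableAt, by rwa [hd.deriv]⟩
  · have habs : ∀ a : ℝ, |a| = |(-1 : ℝ) ^ (k - 1) * a| := fun a => by
      rw [abs_mul, abs_pow, abs_neg, abs_one, one_pow, one_mul]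
    rw [habs, habs (isingUrsell G j J'), abs_of_nonneg (isingUrsell_sign G hJ hk j),
      abs_of_nonneg (isingUrsell_sign G (fun e => (hJ e).trans (hJJ' e)) hk j)]
    exact isingUrsell_mono G hJ hJJ' hk j
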